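/- **Conventions.** All graphs are finite; patterns are simple undirected graphs, and an acyclic orientation of a pattern directs each edge so that the result is a DAG. In a DAG $D$, a *source* is a vertex of in-degree $0$; for a set $B$ of vertices, $\mathrm{Reach}_D(B)$ is the set of vertices reachable from a vertex of $B$ by a directed path (of length $\ge 0$). An *intersection vertex* is a vertex reachable from two distinct sources; $I(D)$ is the set of these. For a set $S$ of sources, $D(S)$ is the subgraph induced by $\mathrm{Reach}_D(S)$. A *DAG-tree decomposition* of $D$ is a rooted tree each of whose nodes carries a bag of sources of $D$, such that the bags cover all sources and, whenever the node of a bag $B$ lies on the tree path between the nodes of bags $B_1$ and $B_2$, $\mathrm{Reach}_D(B_1)\cap \mathrm{Reach}_D(B_2)\subseteq \mathrm{Reach}_D(B)$. Its width is the maximum size of a bag, and the *DAG-treewidth* $\tau(D)$ is the minimum width of a DAG-tree decomposition. For $l\ge 3$, a (weakly) connected DAG $D$ is *$C_l$-reducible* if there are pairwise disjoint sets of sources $S_1,\dots,S_l$ whose union is the set of all sources, sources $s_i\in S_i$, and sets $I_1,\dots,I_l\subseteq I(D)$ with union $I^*$ (indices modulo $l$) such that: each $D(S_i)$ has a DAG-tree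 decomposition of width $1$ whose root bag is $\{s_i\}$; for each vertex $x$, the indices $i$ with $x\in I_i$ are cyclically consecutive; and for every $i$ 1. $\mathrm{Reach}(S_i)\cap \mathrm{Reach}(S_{i+1})=I_i$; 2. $I_{i-1}\cup I_i=\mathrm{Reach}(S_i)\cap I^*$; 3. for all $j\ne i$, $\mathrm{Reach}(S_i)\cap \mathrm{Reach}(S_j)=\mathrm{Reach}(\{s_i\})\cap \mathrm{Reach}(\{s_j\})\subseteq I^*$. A pattern $H$ is *$C_k$-computable* if every acyclic orientation of $H$ has DAG-treewidth $1$ or is $C_l$-reducible for some $l\le k$. $\mathrm{LICL}(H)$ is the maximum length of an induced cycle of $H$ ($0$ if there is none). **Statement.** (a) Let $P,P'$ be DAGs with $\tau(P)=\tau(P')=1$. If $P''$ is obtained from the disjoint union of $P$ and $P'$ either by merging a vertex $u$ of $P$ with a vertex $u'$ of $P'$, or, for arcs $u\to v$ of $P$ and $u'\to v'$ of $P'$, by merging $u$ with $u'$ and $v$ with $v'$, then $P''$ is a DAG and $\tau(P'')=1$. (b) Let $H$ be a $C_k$-computable pattern and $H'$ a connected pattern with $\mathrm{LICL}(H')<6$.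 Then each graph obtained from the disjoint union of $H$ and $H'$ by one of the following operations is $C_k$-computable: merging a vertex $u$ of $H$ with a vertex $u'$ of $H'$; or, for an edge $(u,v)$ of $H$ and an edge $(u',v')$ of $H'$, merging $u$ with $u'$ and $v$ with $v'$. -/

import Mathlib

universe u₁ u₂ u₃

namespace CycleComputable

/-! ### Directed acyclic graphs, sources, reachability -/

section Digraphs

variable {V : Type u₁}

/-- A directed graph is a DAG if it has no directed closed walk of positive length. -/
def IsDAG (D : Digraph V) : Prop :=
  ∀ v, ¬ Relation.TransGen D.Adj v v

/-- `D` is an acyclic orientation of the simple graph `G`. (By acyclicity, every edge of `G`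
receives exactly one of its two directions.) -/
def IsAcyclicOrientation (G : SimpleGraph V) (D : Digraph V) : Prop :=
  IsDAG D ∧ ∀ a b, G.Adj a b ↔ (D.Adj a b ∨ D.Adj b a)

/-- The set of sources: vertices without incoming arcs. -/
def sources (D : Digraph V) : Set V :=
  {v | ∀ w, ¬ D.Adj w v}

/-- The set of vertices reachable from some vertex of `S` along a directed path (of length `≥ 0`,
so `S ⊆ reach D S`). -/
def reach (D : Digraph V) (S : Set V) : Set V :=
  {v | ∃ s ∈ S, Relation.ReflTransGen D.Adj s v}

/-- The set of intersection vertices: vertices reachable from two distinct sources. -/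
def intersectionVertices (D : Digraph V) : Set V :=
  {v | ∃ s ∈ sources D, ∃ s' ∈ sources D, s ≠ s' ∧ v ∈ reach D {s} ∧ v ∈ reach D {s'}}

/-- The subgraph of `D` induced by a set of vertices. -/
def inducedDigraph (D : Digraph V) (A : Set V) : Digraph A where
  Adj x y := D.Adj x.1 y.1

/-- The subgraph of `D` induced by the vertices reachable from `S`. -/
def reachDigraph (D : Digraph V) (S : Set V) : Digraph (reach D S) :=
  inducedDigraph D (reach D S)

/-! ### DAG-tree decompositions -/

/-- A DAG-tree decomposition of `D`: a rooted tree on the node set `ι`, each node carrying a bag of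
sources, such that the bags cover the sources and, whenever `b` lies on the path between `b₁` and
`b₂`, everything reachable from both bags of `b₁` and `b₂` is reachable from the bag of `b`. -/
structure DagTreeDecomposition (D : Digraph V) (ι : Type u₂) where
  tree : SimpleGraph ι
  isTree : tree.IsTree
  root : ι
  bag : ι → Set V
  bag_subset : ∀ b, bag b ⊆ sources D
  cover : ⋃ b, bag b = sources D
  reach_inter : ∀ (b₁ b₂ b : ι) (p : tree.Walk b₁ b₂), p.IsPath → b ∈ p.support →
    reach D (bag b₁) ∩ reach D (bag b₂) ⊆ reach D (bag b)

/-- The width of a decomposition: the maximum size of its bags. -/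
noncomputable def DagTreeDecomposition.width {D : Digraph V} {ι : Type u₂} [Fintype ι]
    (T : DagTreeDecomposition D ι) : ℕ :=
  Finset.univ.sup fun b => (T.bag b).ncard

/-- The DAG-treewidth of a (finite) directed graph: the minimum width over all its (finite)
DAG-tree decompositions. -/
noncomputable def dagTreewidth (D : Digraph V) : ℕ :=
  sInf {w | ∃ (ι : Type) (_ : Fintype ι) (T : DagTreeDecomposition D ι), T.width = w}

/-- `D` admits a DAG-tree decomposition of width `1` whose root bag is `{r}`. -/
def HasWidthOneDecompositionRootedAt (D : Digraph V) (r : V) : Prop :=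
  ∃ (ι : Type) (_ : Fintype ι) (T : DagTreeDecomposition D ι), T.width = 1 ∧ T.bag T.root = {r}

/-! ### Reducibility and computability -/

/-- The data showing that `D` reduces to a cycle on `k` vertices; all indices are modulo `k`.
Here `S i` are the source sets, `s i` the distinguished sources and `I i` the intersection sets. -/
structure CycleReduction (D : Digraph V) (k : ℕ) where
  S : ZMod k → Set V
  s : ZMod k → V
  I : ZMod k → Set V
  /-- The source sets partition the set of sources. -/
  disjoint : ∀ i j, i ≠ j → Disjoint (S i) (S j)
  cover : ⋃ i, S i = sources D
  s_mem : ∀ i, s i ∈ S i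
  rooted : ∀ i, ∃ r : reach D (S i), r.1 = s i ∧
    HasWidthOneDecompositionRootedAt (reachDigraph D (S i)) r
  /-- The intersection sets consist of intersection vertices, and the intersection sets containing
  a given vertex are cyclically consecutive: if `I i` and `I (i + m)` contain `x`, then so do all
  the sets on one of the two arcs between these indices. -/
  I_subset : ∀ i, I i ⊆ intersectionVertices D
  consecutive : ∀ (x : V) (i : ZMod k) (m : ℕ), m < k → x ∈ I i → x ∈ I (i + (m : ZMod k)) →
    (∀ t : ℕ, t < m → x ∈ I (i + (t : ZMod k))) ∨
      (∀ t : ℕ, m < t → t < k → x ∈ I (i + (t : ZMod k)))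
  inter_succ : ∀ i, reach D (S i) ∩ reach D (S (i + 1)) = I i
  union_eq : ∀ i, I (i - 1) ∪ I i = reach D (S i) ∩ ⋃ j, I j
  inter_eq : ∀ i j, j ≠ i →
    reach D (S i) ∩ reach D (S j) = reach D {s i} ∩ reach D {s j}
  inter_subset : ∀ i j, j ≠ i → reach D {s i} ∩ reach D {s j} ⊆ ⋃ m, I m

/-- A (weakly) connected DAG is reducible to the `k`-cycle, `k ≥ 3`, if it has a cycle reduction
with `k` source sets. -/
def IsCycleReducible (k : ℕ) (D : Digraph V) : Prop :=
  3 ≤ k ∧ IsDAG D ∧ D.toSimpleGraphInclusive.Connected ∧ Nonempty (CycleReduction D k)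

/-- A pattern is computable by the `k`-cycle if each of its acyclic orientations has DAG-treewidth
`1` or is reducible to an `l`-cycle for some `l ≤ k`. -/
def IsCycleComputable (k : ℕ) (G : SimpleGraph V) : Prop :=
  ∀ D : Digraph V, IsAcyclicOrientation G D →
    dagTreewidth D = 1 ∨ ∃ l ≤ k, IsCycleReducible l D

/-- The longest induced cycle length of a (finite) graph; it is `0` if there is no induced
cycle. -/
noncomputable def licl (G : SimpleGraph V) : ℕ :=
  sSup {n | 3 ≤ n ∧ Nonempty (SimpleGraph.cycleGraph n ↪g G)}

end Digraphs

/-! ### Gluing -/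

section Gluing

variable {V : Type u₁} {V' : Type u₂} {W : Type u₃}

/-- The graph with adjacency relation `t` on `W` is obtained from the disjoint union of the graphs
`r` on `V` and `r'` on `V'` by merging `x : V` with `y : V'` exactly when `R x y`: both vertex sets
embed in `W` and cover it, they overlap as prescribed by `R`, and the edges are those coming
from `r` and those coming from `r'`. -/
def IsGluing (R : V → V' → Prop) (r : V → V → Prop) (r' : V' → V' → Prop) (t : W → W → Prop) :
    Prop :=
  ∃ (f : V ↪ W) (f' : V' ↪ W),
    Set.range f ∪ Set.range f' = Set.univ ∧
    (∀ x y, f x = f' y ↔ R x y) ∧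
    ∀ a b, t a b ↔ (Relation.Map r f f a b ∨ Relation.Map r' f' f' a b)

/-- Gluing along a vertex: `u` is merged with `u'`, and nothing else is merged. -/
def IsVertexGluing (u : V) (u' : V') (r : V → V → Prop) (r' : V' → V' → Prop)
    (t : W → W → Prop) : Prop :=
  IsGluing (fun x y => x = u ∧ y = u') r r' t

/-- Gluing along an edge: `u` is merged with `u'`, `v` with `v'`, and nothing else is merged. -/
def IsEdgeGluing (u v : V) (u' v' : V') (r : V → V → Prop) (r' : V' → V' → Prop)
    (t : W → W → Prop) : Prop :=
  IsGluing (fun x y => (x = u ∧ y = u') ∨ (x = v ∧ y = v')) r r' t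

end Gluing

end CycleComputable

/-!
The reachability sets of the sources of a directed acyclic graph form a hypergraph, and the DAG has
DAG-treewidth one exactly when this hypergraph has a join tree (`dagTreewidth_eq_one_iff`): a tree
on the sources in which every vertex is reachable from a connected set of nodes. Such a tree can be
rooted anywhere, so the roots demanded by a cycle reduction are no further restriction
(`rooted_reachDigraph_iff`).

*Gluing.* Let `D''` be glued from `D` and `D'` along a vertex `u` or along arcs merged to `u → v`. A
directed path between two vertices of one part can be shortcut inside this part, and a path from one
part to the other crosses over once, at `u` or at `v`. Hence, as far as reachability from `D` is
concerned, each vertex of `D'` is either invisible or behaves like `u` or `v`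
(`DagGluing.exists_pullback`), so supports in a join tree of `D` stay connected. A vertex reachable
from both parts is reachable from `u`, so two join trees can be connected by an edge between two nodes
that reach `u` (`DagGluing.hasJoinTree_union`). If `u` is a source of one part only, then it is no
longer a source; but the set of a source above it contains its set, and sets contained in another
one can be dropped from a join tree (`HasJoinTree.diff_singleton`). This gives the first half.

*Patterns without long induced cycles.* Every orientation of `H'` has a join tree
(`hasJoinTree_sources`). Take a spanning tree on the sources that has maximum weight, where a pair
`i`, `j` weighs the number of common descendants, in the form that Kruskal's algorithm
provides (`exists_isTree_weight_le`). If this is not a join tree, then some common descendant `x` of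
two sources `i`, `j` is not reachable from any source inside the tree path between them. The weights
provide a connection from `i` to `j` along this path which avoids the common descendants of `i` and
`j`. Together with a short connection close to `x` it yields an induced cycle of length at least six
(`exists_long_induced_cycle`).

*Computable patterns.* An orientation of the glued pattern restricts to orientations of `H` and `H'`.
If the one of `H` has DAG-treewidth one, the first half applies. If it has a cycle reduction, all
sources of `H'` are added to one part whose reachability set contains `u`; the intersections
of the parts are then pulled back from `H`, and all conditions of a cycle reduction carry over
(`DagGluing.nonempty_cycleReduction`).
-/

namespace CycleComputable

/-! ### Induced paths and induced cycles -/

section InducedCycles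

variable {V : Type u₁}

open Relation

/-- A shortest chain of a relation from a set `A` to a set `C`: it has no shortcut, and it meets `A`
and `C` only in its ends. -/
theorem exists_shortest_chain (r : V → V → Prop) (A C : Set V) {a c : V} (ha : a ∈ A) (hc : c ∈ C)
    (h : ReflTransGen r a c) :
    ∃ (n : ℕ) (p : ℕ → V), p 0 ∈ A ∧ p n ∈ C ∧ (∀ t < n, r (p t) (p (t + 1))) ∧
      (∀ s t, s + 1 < t → t ≤ n → ¬ r (p s) (p t)) ∧
      (∀ t, 0 < t → t ≤ n → p t ∉ A) ∧ (∀ t < n, p t ∉ C) := by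
  classical
  have hex : ∃ (n : ℕ) (p : ℕ → V), p 0 ∈ A ∧ p n ∈ C ∧ ∀ t < n, r (p t) (p (t + 1)) := by
    suffices H : ∃ (n : ℕ) (p : ℕ → V), p 0 = a ∧ p n = c ∧ ∀ t < n, r (p t) (p (t + 1)) by
      obtain ⟨n, p, h0, hn, hp⟩ := H
      exact ⟨n, p, h0 ▸ ha, hn ▸ hc, hp⟩
    clear hc
    induction h with
    | refl => exact ⟨0, fun _ => a, rfl, rfl, by simp⟩
    | @tail b c _ hbc ih =>
      obtain ⟨n, p, h0, hn, hp⟩ := ih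
      refine ⟨n + 1, fun t => if t ≤ n then p t else c, by simp [h0], by simp, fun t ht => ?_⟩
      rcases Nat.lt_succ_iff_lt_or_eq.1 ht with h | rfl
      · simpa [h.le, Nat.succ_le_of_lt h] using hp t h
      · simpa [hn] using hbc
  obtain ⟨p, h0, hn, hp⟩ := Nat.find_spec hex
  have hmin : ∀ m < Nat.find hex, ¬ ∃ p : ℕ → V, p 0 ∈ A ∧ p m ∈ C ∧ ∀ t < m, r (p t) (p (t + 1)) :=
    fun m hm => Nat.find_min hex hm
  generalize Nat.find hex = n at hn hp hmin
  -- In each case a strictly shorter chain contradicts the minimality of `n`: the chain with the part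
  -- between `s` and `t` cut out, a final part, or an initial part.
  refine ⟨n, p, h0, hn, hp, fun s t hst htn hr => ?_, fun t ht htn hA => ?_, fun t ht hC => ?_⟩
  · refine hmin (n - (t - s - 1)) (by omega)
      ⟨fun m => if m ≤ s then p m else p (m + (t - s - 1)), by simpa using h0, ?_, fun m hm => ?_⟩
    · have h1 : ¬ n - (t - s - 1) ≤ s := by omega
      have h2 : n - (t - s - 1) + (t - s - 1) = n := by omega
      simpa [h1, h2] using hn
    · rcases lt_trichotomy m s with h | rfl | h
      · simpa [h.le, Nat.succ_le_of_lt h] using hp m (by omega)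
      · have h2 : m + 1 + (t - m - 1) = t := by omega
        simpa [h2] using hr
      · have h1 : ¬ m ≤ s := by omega
        have h2 : ¬ m + 1 ≤ s := by omega
        have h3 : m + 1 + (t - s - 1) = m + (t - s - 1) + 1 := by omega
        simpa [h1, h2, h3] using hp (m + (t - s - 1)) (by omega)
  · refine hmin (n - t) (by omega) ⟨fun m => p (m + t), by simpa using hA, ?_, fun m hm => ?_⟩
    · simpa [Nat.sub_add_cancel htn] using hn
    · have := hp (m + t) (by omega)
      rwa [show m + t + 1 = m + 1 + t by omega] at this
  · exact hmin t ht ⟨p, h0, hC, fun m hm => hp m (by omega)⟩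

/-- The vertices `p 0, …, p n` are pairwise distinct and induce a path, in this order. -/
def IsInducedPath (G : SimpleGraph V) (n : ℕ) (p : ℕ → V) : Prop :=
  ∀ s t, s < t → t ≤ n → p s ≠ p t ∧ (G.Adj (p s) (p t) ↔ t = s + 1)

/-- A shortest path inside `X` from `A` to `C` is induced and meets `A` and `C` only in its ends. -/
theorem exists_inducedPath (G : SimpleGraph V) (X A C : Set V) {a c : V} (ha : a ∈ A) (hc : c ∈ C)
    (hAC : Disjoint A C)
    (h : ReflTransGen (fun x y => G.Adj x y ∧ x ∈ X ∧ y ∈ X) a c) :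
    ∃ (n : ℕ) (p : ℕ → V), IsInducedPath G n p ∧ p 0 ∈ A ∧ p n ∈ C ∧ (∀ t ≤ n, p t ∈ X) ∧
      (∀ t, 0 < t → t ≤ n → p t ∉ A) ∧ (∀ t < n, p t ∉ C) := by
  obtain ⟨n, p, h0, hn, hp, hsc, hA, hC⟩ := exists_shortest_chain _ A C ha hc h
  have hpos : 0 < n := by
    rcases Nat.eq_zero_or_pos n with rfl | h
    · exact absurd hn (Set.disjoint_left.1 hAC h0)
    · exact h
  have hX : ∀ t ≤ n, p t ∈ X := fun t ht => by
    rcases ht.lt_or_eq with h | rfl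
    · exact (hp t h).2.1
    · obtain ⟨m, rfl⟩ := Nat.exists_eq_succ_of_ne_zero hpos.ne'
      exact (hp m (by omega)).2.2
  refine ⟨n, p, fun s t hst htn => ⟨fun he => ?_, fun hadj => ?_, ?_⟩, h0, hn, hX, hA, hC⟩
  · rcases htn.lt_or_eq with h | rfl
    · exact hsc s (t + 1) (by omega) h (he ▸ hp t h)
    · exact hC s hst (he ▸ hn)
  · by_contra hne
    exact hsc s t (by omega) htn ⟨hadj, hX s (by omega), hX t htn⟩
  · rintro rfl
    exact (hp s htn).1

theorem nonempty_cycleGraph_embedding (G : SimpleGraph V) {N : ℕ} (c : ℕ → V)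
    (hc : ∀ s t, s < t → t < N → c s ≠ c t ∧ (G.Adj (c s) (c t) ↔ t = s + 1 ∨ (s = 0 ∧ t + 1 = N))) :
    Nonempty (SimpleGraph.cycleGraph N ↪g G) := by
  refine ⟨⟨⟨fun i => c i, fun i j hij => ?_⟩, ?_⟩⟩
  · rcases lt_trichotomy i j with h | h | h
    · exact absurd hij (hc i j h j.2).1
    · exact h
    · exact absurd hij.symm (hc j i h i.2).1
  · have key : ∀ i j : Fin N, i < j → (G.Adj (c i) (c j) ↔ (SimpleGraph.cycleGraph N).Adj i j) := by
      intro i j hij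
      have hij' : (i : ℕ) < j := hij
      have hjN := j.2
      rw [(hc i j hij j.2).2, SimpleGraph.cycleGraph_adj', Fin.sub_def, Fin.sub_def]
      have h1 : (N - (j : ℕ) + i) % N = N - j + i := Nat.mod_eq_of_lt (by omega)
      have h2 : (N - (i : ℕ) + j) % N = j - i := by
        rw [show N - (i : ℕ) + j = (j - i) + N by omega, Nat.add_mod_right,
          Nat.mod_eq_of_lt (by omega)]
      simp only [h1, h2]
      omega
    intro i j
    change G.Adj (c i) (c j) ↔ _
    rcases lt_trichotomy i j with h | rfl | h
    · exact key i j h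
    · simp
    · exact (G.adj_comm _ _).trans ((key j i h).trans (SimpleGraph.adj_comm _ _ _))

/-- Two induced paths with common ends whose interiors are disjoint and not joined by an edge form
an induced cycle. -/
theorem IsInducedPath.nonempty_cycleGraph_embedding {G : SimpleGraph V} {n l : ℕ} {p q : ℕ → V}
    (hp : IsInducedPath G n p) (hq : IsInducedPath G l q) (hn : 2 ≤ n) (hl : 2 ≤ l)
    (h0 : p 0 = q 0) (h1 : p n = q l)
    (hpq : ∀ s t, 0 < s → s < n → 0 < t → t < l → p s ≠ q t ∧ ¬ G.Adj (p s) (q t)) :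
    Nonempty (SimpleGraph.cycleGraph (n + l) ↪g G) := by
  refine CycleComputable.nonempty_cycleGraph_embedding G
    (fun t => if t ≤ n then p t else q (n + l - t)) fun s t hst ht => ?_
  by_cases htn : t ≤ n
  · obtain ⟨h2, h3⟩ := hp s t hst htn
    simp only [htn, if_true, show s ≤ n by omega]
    exact ⟨h2, h3.trans (by omega)⟩
  by_cases hsn : s ≤ n
  · simp only [htn, hsn, if_true, if_false]
    rcases Nat.eq_zero_or_pos s with rfl | hs
    · obtain ⟨h2, h3⟩ := hq 0 (n + l - t) (by omega) (by omega)
      rw [h0]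
      exact ⟨h2, h3.trans (by omega)⟩
    rcases hsn.lt_or_eq with hs' | rfl
    · obtain ⟨h2, h3⟩ := hpq s (n + l - t) hs hs' (by omega) (by omega)
      exact ⟨h2, iff_of_false h3 (by omega)⟩
    · obtain ⟨h2, h3⟩ := hq (s + l - t) l (by omega) le_rfl
      rw [h1, G.adj_comm]
      exact ⟨h2.symm, h3.trans (by omega)⟩
  · simp only [htn, hsn, if_false]
    obtain ⟨h2, h3⟩ := hq (n + l - t) (n + l - s) (by omega) (by omega)
    rw [G.adj_comm]
    exact ⟨h2.symm, h3.trans (by omega)⟩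

end InducedCycles

/-! ### Long induced cycles from two sources with a common descendant -/

section LongCycle

variable {V : Type u₁}

open Relation

theorem mem_reach_singleton {D : Digraph V} {s v : V} :
    v ∈ reach D {s} ↔ ReflTransGen D.Adj s v := by
  simp [reach]

/-- A directed path from outside `R` into `R` has an arc entering `R`. -/
theorem exists_arc_into {r : V → V → Prop} {R : Set V} {i x : V} (h : ReflTransGen r i x)
    (hi : i ∉ R) (hx : x ∈ R) :
    ∃ a b, ReflTransGen r i a ∧ r a b ∧ ReflTransGen r b x ∧ a ∉ R ∧ b ∈ R := by
  induction h using ReflTransGen.head_induction_on with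
  | refl => exact absurd hx hi
  | @head i c hic hcx ih =>
    by_cases hc : c ∈ R
    · exact ⟨i, c, .refl, hic, hcx, hi, hc⟩
    · obtain ⟨a, b, h1, h2, h3, h4, h5⟩ := ih hc
      exact ⟨a, b, .head hic h1, h2, h3, h4, h5⟩

theorem reflTransGen_symm {r : V → V → Prop} (hr : ∀ a b, r a b → r b a) {a b : V}
    (h : ReflTransGen r a b) : ReflTransGen r b a := by
  induction h with
  | refl => exact .refl
  | tail _ hbc ih => exact .head (hr _ _ hbc) ih

/-- A directed path stays within any set containing all vertices between its ends. -/
theorem reflTransGen_within {D : Digraph V} {G : SimpleGraph V}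
    (hG : ∀ a b, D.Adj a b → G.Adj a b) {X : Set V} {a b : V} (h : ReflTransGen D.Adj a b)
    (hX : ∀ v, ReflTransGen D.Adj a v → ReflTransGen D.Adj v b → v ∈ X) :
    ReflTransGen (fun x y => G.Adj x y ∧ x ∈ X ∧ y ∈ X) a b := by
  induction h with
  | refl => exact .refl
  | @tail b c hab hbc ih =>
    exact (ih fun v h1 h2 => hX v h1 (h2.tail hbc)).tail
      ⟨hG _ _ hbc, hX b hab (.single hbc), hX c (hab.tail hbc) .refl⟩

/-- Let `x` be reachable from `i` and `j`, but from no other vertex of `P`, and let `i` and `j` be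
joined by a path in `reach D P` avoiding the common descendants `R` of `i` and `j`. Then there is an
induced cycle of length at least six: it consists of a path of length at least two through
`R`, close to `x`, and a path of length at least four avoiding `R`. -/
theorem exists_long_induced_cycle {D : Digraph V} {G : SimpleGraph V}
    (hD : ∀ a b, G.Adj a b ↔ (D.Adj a b ∨ D.Adj b a)) {P : Set V} {i j x : V}
    (hi : i ∈ P) (hj : j ∈ P)
    (hix : ReflTransGen D.Adj i x) (hjx : ReflTransGen D.Adj j x)
    (hP : ∀ q ∈ P, ReflTransGen D.Adj q x → q = i ∨ q = j)
    (hiR : i ∉ reach D {i} ∩ reach D {j}) (hjR : j ∉ reach D {i} ∩ reach D {j})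
    (hij : ReflTransGen (fun a b => G.Adj a b ∧ a ∈ reach D P \ (reach D {i} ∩ reach D {j}) ∧
      b ∈ reach D P \ (reach D {i} ∩ reach D {j})) i j) :
    ∃ n, 6 ≤ n ∧ Nonempty (SimpleGraph.cycleGraph n ↪g G) := by
  set R := reach D {i} ∩ reach D {j} with hRdef
  have hR : ∀ v, v ∈ R ↔ ReflTransGen D.Adj i v ∧ ReflTransGen D.Adj j v := fun v => by
    simp [hRdef, mem_reach_singleton]
  have hRout : ∀ {v w}, v ∈ R → ReflTransGen D.Adj v w → w ∈ R := fun hv hw =>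
    (hR _).2 ⟨((hR _).1 hv).1.trans hw, ((hR _).1 hv).2.trans hw⟩
  set Y := reach D P \ R with hY
  have hGD : ∀ a b, D.Adj a b → G.Adj a b := fun a b h => (hD a b).2 (.inl h)
  -- The part of `R` above `x`, and the vertices outside `R` on either side with an arc into it.
  let B : Set V := {v | v ∈ R ∧ ReflTransGen D.Adj v x}
  let N : V → Set V := fun k => {v | ReflTransGen D.Adj k v ∧ v ∉ R ∧ ∃ b ∈ B, D.Adj v b}
  have hxR : x ∈ R := (hR x).2 ⟨hix, hjx⟩
  have hNx : ∀ k, ∀ v ∈ N k, ReflTransGen D.Adj v x := fun k v ⟨_, _, b, hb, hvb⟩ =>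
    .head hvb hb.2
  have hsub : ∀ k ∈ P, ∀ v, ReflTransGen D.Adj k v → v ∉ R → v ∈ Y := fun k hk v hv hvR =>
    ⟨⟨k, hk, hv⟩, hvR⟩
  -- Neighbours of `N k` outside `R` are descendants of `k`.
  have hnb : ∀ k l, (∀ v, v ∈ R ↔ ReflTransGen D.Adj k v ∧ ReflTransGen D.Adj l v) →
      (∀ q ∈ P, ReflTransGen D.Adj q x → q = k ∨ q = l) →
      ∀ v ∈ N k, ∀ w ∈ Y, G.Adj v w → ReflTransGen D.Adj k w := by
    intro k l hR' hP' v hv w hw hvw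
    rcases (hD v w).1 hvw with h | h
    · exact hv.1.tail h
    · obtain ⟨q, hq, hqw⟩ := hw.1
      rcases hP' q hq ((hqw.tail h).trans (hNx k v hv)) with rfl | rfl
      · exact hqw
      · exact absurd ((hR' v).2 ⟨hv.1, hqw.tail h⟩) hv.2.1
  have hnbi := hnb i j hR hP
  have hnbj := hnb j i (fun v => (hR v).trans and_comm) (fun q hq h => (hP q hq h).symm)
  -- The two sides are not adjacent.
  have hsep : ∀ v w, ReflTransGen D.Adj i v → ReflTransGen D.Adj j w → v ∉ R → w ∉ R →
      v ≠ w ∧ ¬ G.Adj v w := by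
    intro v w hv hw hvR hwR
    refine ⟨fun h => hvR ((hR v).2 ⟨hv, h ▸ hw⟩), fun h => ?_⟩
    rcases (hD v w).1 h with h | h
    · exact hwR ((hR w).2 ⟨hv.tail h, hw⟩)
    · exact hvR ((hR v).2 ⟨hv, hw.tail h⟩)
  obtain ⟨a₀, b₁, ha₀, hab₁, hb₁, ha₀R, hb₁R⟩ := exists_arc_into hix hiR hxR
  obtain ⟨c₀, b₂, hc₀, hcb₂, hb₂, hc₀R, hb₂R⟩ := exists_arc_into hjx hjR hxR
  have hN_ne : a₀ ∈ N i := ⟨ha₀, ha₀R, b₁, ⟨hb₁R, hb₁⟩, hab₁⟩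
  have hN_ne' : c₀ ∈ N j := ⟨hc₀, hc₀R, b₂, ⟨hb₂R, hb₂⟩, hcb₂⟩
  have hsymm : ∀ X : Set V, ∀ a b, (G.Adj a b ∧ a ∈ X ∧ b ∈ X) → (G.Adj b a ∧ b ∈ X ∧ a ∈ X) :=
    fun X a b h => ⟨h.1.symm, h.2.2, h.2.1⟩
  have hconn : ReflTransGen (fun a b => G.Adj a b ∧ a ∈ Y ∧ b ∈ Y) a₀ c₀ := by
    refine (reflTransGen_symm (hsymm Y) ?_).trans (hij.trans ?_)
    · exact reflTransGen_within hGD ha₀ fun v h1 h2 => hsub i hi v h1 fun h => ha₀R (hRout h h2)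
    · exact reflTransGen_within hGD hc₀ fun v h1 h2 => hsub j hj v h1 fun h => hc₀R (hRout h h2)
  obtain ⟨n, p, hp, hp0, hpn, hpY, hpA, hpC⟩ := exists_inducedPath G Y (N i) (N j) hN_ne hN_ne'
    (Set.disjoint_left.2 fun v h1 h2 => h1.2.1 ((hR v).2 ⟨h1.1, h2.1⟩)) hconn
  -- The second vertex of the path is a descendant of `i`, the last but one a descendant of `j`.
  have hn : 4 ≤ n := by
    by_contra hlt
    obtain ⟨hne, hadj⟩ := hsep _ _ hp0.1 hpn.1 hp0.2.1 hpn.2.1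
    have h1 : n ≠ 0 := by rintro rfl; exact hne rfl
    have h2 : n ≠ 1 := by rintro rfl; exact hadj ((hp 0 1 one_pos le_rfl).2.2 rfl)
    have hl := hnbi _ hp0 _ (hpY 1 (by omega)) ((hp 0 1 one_pos (by omega)).2.2 rfl)
    have hr := hnbj _ hpn _ (hpY (n - 1) (by omega))
      ((hp (n - 1) n (by omega) le_rfl).2.2 (by omega)).symm
    obtain ⟨hne', hadj'⟩ := hsep _ _ hl hr (hpY 1 (by omega)).2 (hpY (n - 1) (by omega)).2
    have h3 : n ≠ 2 := by rintro rfl; exact hne' rfl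
    obtain rfl : n = 3 := by omega
    exact hadj' ((hp 1 2 (by omega) (by omega)).2.2 rfl)
  -- The second path runs through `B`.
  obtain ⟨-, haR, b, hb, hab⟩ := id hp0
  obtain ⟨-, hcR, d, hd, hcd⟩ := id hpn
  have hBconn : ∀ v ∈ B,
      ReflTransGen (fun a b => G.Adj a b ∧ a ∈ insert (p 0) (insert (p n) B) ∧
        b ∈ insert (p 0) (insert (p n) B)) v x := fun v hv =>
    reflTransGen_within hGD hv.2 fun w h1 h2 => .inr (.inr ⟨hRout hv.1 h1, h2⟩)
  obtain ⟨hne, hadj⟩ := hsep _ _ hp0.1 hpn.1 hp0.2.1 hpn.2.1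
  obtain ⟨l, q, hq, hq0, hql, hqB, hqA, hqC⟩ := exists_inducedPath G
    (insert (p 0) (insert (p n) B)) {p 0} {p n} rfl rfl (by simpa using hne)
    (((hBconn b hb).head ⟨hGD _ _ hab, by simp, by simp [hb]⟩).trans
      (reflTransGen_symm (hsymm _) ((hBconn d hd).head ⟨hGD _ _ hcd, by simp, by simp [hd]⟩)))
  rw [Set.mem_singleton_iff] at hq0 hql
  have hl : 2 ≤ l := by
    by_contra hlt
    have h1 : l ≠ 0 := by rintro rfl; exact hne (hq0.symm.trans hql)
    obtain rfl : l = 1 := by omega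
    exact hadj (hq0 ▸ hql ▸ (hq 0 1 one_pos le_rfl).2.2 rfl)
  refine ⟨n + l, by omega, hp.nonempty_cycleGraph_embedding hq (by omega) hl hq0.symm hql.symm
    fun s t hs hsn ht htl => ?_⟩
  have hqt : q t ∈ B := by
    rcases hqB t htl.le with h | h | h
    · exact absurd h (hqA t ht htl.le)
    · exact absurd h (hqC t htl)
    · exact h
  have hps := hpY s hsn.le
  refine ⟨fun h => hps.2 (h ▸ hqt.1), fun h => ?_⟩
  rcases (hD _ _).1 h with h | h
  · obtain ⟨k, hk, hks⟩ := hps.1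
    rcases hP k hk ((hks.tail h).trans hqt.2) with rfl | rfl
    · exact hpA s hs hsn.le ⟨hks, hps.2, _, hqt, h⟩
    · exact hpC s hsn ⟨hks, hps.2, _, hqt, h⟩
  · exact hps.2 (hRout hqt.1 (.single h))

end LongCycle

/-! ### Join trees -/

section JoinTrees

variable {V : Type u₁}

open Relation

theorem subset_reach (D : Digraph V) (S : Set V) : S ⊆ reach D S :=
  fun s hs => ⟨s, hs, .refl⟩

theorem reach_mono (D : Digraph V) {S S' : Set V} (h : S ⊆ S') : reach D S ⊆ reach D S' :=
  fun _ ⟨s, hs, hv⟩ => ⟨s, h hs, hv⟩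

theorem mem_reach_of_reflTransGen {D : Digraph V} {S : Set V} {v w : V} (hv : v ∈ reach D S)
    (h : ReflTransGen D.Adj v w) : w ∈ reach D S :=
  let ⟨s, hs, hsv⟩ := hv
  ⟨s, hs, hsv.trans h⟩

/-- Every point lies in the sets attached to a connected set of nodes of `T`. -/
def HasConnectedSupports {ι : Type*} (T : SimpleGraph ι) (E : ι → Set V) : Prop :=
  ∀ x b₁ b₂, x ∈ E b₁ → x ∈ E b₂ →
    ReflTransGen (fun a b => T.Adj a b ∧ x ∈ E a ∧ x ∈ E b) b₁ b₂

/-- In a tree, connectedness of the supports is the intersection condition along tree paths. -/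
theorem hasConnectedSupports_iff {ι : Type*} {T : SimpleGraph ι} (hT : T.IsTree) (E : ι → Set V) :
    HasConnectedSupports T E ↔
      ∀ (b₁ b₂ b : ι) (p : T.Walk b₁ b₂), p.IsPath → b ∈ p.support → E b₁ ∩ E b₂ ⊆ E b := by
  classical
  constructor
  · intro h b₁ b₂ b p hp hb x hx
    obtain ⟨w, hw⟩ : ∃ w : T.Walk b₁ b₂, ∀ c ∈ w.support, x ∈ E c := by
      have := h x b₁ b₂ hx.1 hx.2
      clear hp hb p
      induction this using ReflTransGen.head_induction_on with
      | refl => exact ⟨.nil, by simpa using hx.2⟩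
      | @head a c hac _ ih =>
        obtain ⟨w, hw⟩ := ih ⟨hac.2.2, hx.2⟩
        exact ⟨.cons hac.1 w, by simpa [hac.2.1] using hw⟩
    have hpw : p = w.bypass := (hT.existsUnique_path b₁ b₂).unique hp w.bypass_isPath
    exact hw b (w.support_bypass_subset_support (hpw ▸ hb))
  · intro h x b₁ b₂ h₁ h₂
    obtain ⟨p, hp, -⟩ := hT.existsUnique_path b₁ b₂
    have hall : ∀ b ∈ p.support, x ∈ E b := fun b hb => h b₁ b₂ b p hp hb ⟨h₁, h₂⟩
    clear hp h₁ h₂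
    induction p with
    | nil => exact .refl
    | cons hadj p ih =>
      refine .head ⟨hadj, hall _ (by simp), hall _ (by simp)⟩ (ih fun b hb => hall b (by simp [hb]))

/-- The family of reachability sets of the vertices in `S` has a join tree: a finite tree whose
nodes carry subsets of `S` of size at most one, covering `S`, such that every vertex of `D` is
reachable from the bags of a connected set of nodes. For the set of sources, these are the
DAG-tree decompositions of width at most one, with the root forgotten. The set `S` may
contain vertices that are not sources. -/
def HasJoinTree (D : Digraph V) (S : Set V) : Prop :=
  ∃ (ι : Type) (_ : Finite ι) (T : SimpleGraph ι) (bag : ι → Set V), T.IsTree ∧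
    (∀ b, (bag b).Subsingleton) ∧ ⋃ b, bag b = S ∧
    HasConnectedSupports T fun b => reach D (bag b)

theorem HasJoinTree.of_width_eq_one [Finite V] {D : Digraph V} {ι : Type} [Fintype ι]
    (T : DagTreeDecomposition D ι) (h : T.width = 1) :
    HasJoinTree D (sources D) ∧ (sources D).Nonempty := by
  have hle : ∀ b, (T.bag b).ncard ≤ 1 := fun b =>
    h ▸ Finset.le_sup (f := fun b => (T.bag b).ncard) (Finset.mem_univ b)
  refine ⟨⟨ι, inferInstance, T.tree, T.bag, T.isTree,
    fun b => Set.ncard_le_one_iff_subsingleton.1 (hle b), T.cover,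
    (hasConnectedSupports_iff T.isTree _).2 T.reach_inter⟩, ?_⟩
  by_contra hne
  rw [Set.not_nonempty_iff_eq_empty] at hne
  have h0 : T.width = 0 := by
    refine le_antisymm (Finset.sup_le fun b _ => ?_) (Nat.zero_le _)
    have : T.bag b = ∅ := Set.subset_eq_empty (T.bag_subset b) hne
    simp [this]
  omega

/-- A join tree may be rooted at any source. -/
theorem HasJoinTree.hasWidthOneDecompositionRootedAt [Finite V] {D : Digraph V} {r : V}
    (h : HasJoinTree D (sources D)) (hr : r ∈ sources D) :
    HasWidthOneDecompositionRootedAt D r := by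
  obtain ⟨ι, _, T, bag, hT, hbag, hcov, hconn⟩ := h
  have := Fintype.ofFinite ι
  obtain ⟨b₀, hb₀⟩ := Set.mem_iUnion.1 (hcov ▸ hr)
  have hb₀' : bag b₀ = {r} := (hbag b₀).eq_singleton_of_mem hb₀
  refine ⟨ι, inferInstance, ⟨T, hT, b₀, bag, fun b => hcov ▸ Set.subset_iUnion bag b, hcov,
    (hasConnectedSupports_iff hT _).1 hconn⟩, le_antisymm ?_ ?_, hb₀'⟩
  · exact Finset.sup_le fun b _ => Set.ncard_le_one_iff_subsingleton.2 (hbag b)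
  · refine le_trans (b := (bag b₀).ncard) (by simp [hb₀']) ?_
    exact Finset.le_sup (f := fun b => (bag b).ncard) (Finset.mem_univ b₀)

theorem hasWidthOneDecompositionRootedAt_iff [Finite V] {D : Digraph V} {r : V} :
    HasWidthOneDecompositionRootedAt D r ↔ HasJoinTree D (sources D) ∧ r ∈ sources D := by
  refine ⟨fun ⟨ι, _, T, hw, hroot⟩ => ⟨(HasJoinTree.of_width_eq_one T hw).1, ?_⟩,
    fun h => h.1.hasWidthOneDecompositionRootedAt h.2⟩
  exact T.bag_subset T.root (by simp [hroot])

theorem dagTreewidth_eq_one_iff [Finite V] {D : Digraph V} :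
    dagTreewidth D = 1 ↔ HasJoinTree D (sources D) ∧ (sources D).Nonempty := by
  constructor
  · intro h
    have hmem := Nat.sInf_mem (Nat.nonempty_of_sInf_eq_succ h)
    obtain ⟨ι, _, T, hw⟩ := hmem
    exact HasJoinTree.of_width_eq_one T (hw.trans h)
  · rintro ⟨h, r, hr⟩
    obtain ⟨ι, _, T, hw, -⟩ := h.hasWidthOneDecompositionRootedAt hr
    have hmem : 1 ∈ {w | ∃ (ι : Type) (_ : Fintype ι) (T : DagTreeDecomposition D ι), T.width = w} :=
      ⟨ι, _, T, hw⟩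
    refine le_antisymm (Nat.sInf_le hmem) (Nat.one_le_iff_ne_zero.2 fun h0 => ?_)
    obtain ⟨ι, _, T, hw⟩ := Nat.sInf_mem ⟨1, hmem⟩
    obtain ⟨b, hb⟩ := Set.mem_iUnion.1 (T.cover ▸ hr)
    have h1 : (T.bag b).ncard ≤ 0 := by
      rw [← h0]
      exact (Finset.le_sup (f := fun b => (T.bag b).ncard) (Finset.mem_univ b)).trans hw.le
    rw [Nat.le_zero, Set.ncard_eq_zero] at h1
    simp [h1] at hb

theorem sources_reachDigraph {D : Digraph V} {S : Set V} (hS : S ⊆ sources D) :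
    sources (reachDigraph D S) = Subtype.val ⁻¹' S := by
  ext ⟨v, s, hs, hv⟩
  refine ⟨fun h => ?_, fun h w hw => hS h w.1 hw⟩
  rcases ReflTransGen.cases_tail hv with rfl | ⟨w, hsw, hwv⟩
  · exact hs
  · exact absurd hwv (h ⟨w, s, hs, hsw⟩)

theorem mem_reach_reachDigraph {D : Digraph V} {S : Set V} {A : Set (reach D S)}
    {x : reach D S} : x ∈ reach (reachDigraph D S) A ↔ x.1 ∈ reach D (Subtype.val '' A) := by
  constructor
  · rintro ⟨a, ha, h⟩
    exact ⟨a, ⟨a, ha, rfl⟩, h.lift Subtype.val fun _ _ h => h⟩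
  · rintro ⟨_, ⟨a, ha, rfl⟩, h⟩
    obtain ⟨x, hx⟩ := x
    refine ⟨a, ha, ?_⟩
    change ReflTransGen D.Adj a.1 x at h
    induction h with
    | refl => exact .refl
    | @tail b c hab hbc ih =>
      exact (ih (mem_reach_of_reflTransGen a.2 hab)).tail hbc

/-- Width-one decompositions of the subgraph below a set `S` of sources are join trees for `S`. -/
theorem hasJoinTree_reachDigraph_iff {D : Digraph V} {S : Set V} (hS : S ⊆ sources D) :
    HasJoinTree (reachDigraph D S) (sources (reachDigraph D S)) ↔ HasJoinTree D S := by
  rw [sources_reachDigraph hS]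
  constructor
  · rintro ⟨ι, hι, T, bag, hT, hbag, hcov, hconn⟩
    refine ⟨ι, hι, T, fun b => Subtype.val '' bag b, hT, fun b => (hbag b).image _, ?_,
      fun x b₁ b₂ h₁ h₂ => ?_⟩
    · rw [← Set.image_iUnion, hcov, Set.image_preimage_eq_iff, Subtype.range_coe]
      exact subset_reach D S
    · have hx : x ∈ reach D S := by
        obtain ⟨_, ⟨a, -, rfl⟩, h⟩ := h₁
        exact mem_reach_of_reflTransGen a.2 h
      simpa only [mem_reach_reachDigraph] using hconn ⟨x, hx⟩ b₁ b₂
        (mem_reach_reachDigraph.2 h₁) (mem_reach_reachDigraph.2 h₂)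
  · rintro ⟨ι, hι, T, bag, hT, hbag, hcov, hconn⟩
    have himage : ∀ b, Subtype.val '' (Subtype.val ⁻¹' bag b : Set (reach D S)) = bag b := fun b => by
      rw [Set.image_preimage_eq_iff, Subtype.range_coe]
      exact (hcov ▸ Set.subset_iUnion bag b : bag b ⊆ S).trans (subset_reach D S)
    refine ⟨ι, hι, T, fun b => Subtype.val ⁻¹' bag b, hT,
      fun b => (hbag b).preimage Subtype.val_injective, ?_, fun x b₁ b₂ h₁ h₂ => ?_⟩
    · rw [← Set.preimage_iUnion, hcov]
    · simp only [mem_reach_reachDigraph, himage] at h₁ h₂ ⊢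
      exact hconn x b₁ b₂ h₁ h₂

theorem rooted_reachDigraph_iff [Finite V] {D : Digraph V} {S : Set V} (hS : S ⊆ sources D)
    {s : V} :
    (∃ r : reach D S, r.1 = s ∧ HasWidthOneDecompositionRootedAt (reachDigraph D S) r) ↔
      HasJoinTree D S ∧ s ∈ S := by
  simp only [hasWidthOneDecompositionRootedAt_iff, hasJoinTree_reachDigraph_iff hS]
  rw [sources_reachDigraph hS]
  constructor
  · rintro ⟨r, rfl, h⟩
    exact h
  · exact fun h => ⟨⟨s, subset_reach D S h.2⟩, rfl, h⟩

/-- A vertex that is reachable from another vertex of `S` may be dropped from `S`: as long as some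
node carries it, there is such a node with a neighbour whose bag reaches it, and the bag of the
neighbour can replace its bag. -/
theorem HasJoinTree.diff_singleton {D : Digraph V} {S : Set V} {u a : V} (h : HasJoinTree D S)
    (ha : a ∈ S) (hne : a ≠ u) (hau : ReflTransGen D.Adj a u) : HasJoinTree D (S \ {u}) := by
  classical
  obtain ⟨ι, _, T, bag, hT, hbag, hcov, hconn⟩ := h
  -- Induction on the number of nodes carrying `u`.
  have key : ∀ (n : ℕ) (bag : ι → Set V), (∀ b, (bag b).Subsingleton) → S \ {u} ⊆ ⋃ b, bag b →
      ⋃ b, bag b ⊆ S → HasConnectedSupports T (fun b => reach D (bag b)) →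
      {b | bag b = {u}}.ncard = n → HasJoinTree D (S \ {u}) := by
    intro n
    induction n with
    | zero =>
      intro bag hbag h₁ h₂ hconn hn
      rw [Set.ncard_eq_zero] at hn
      refine ⟨ι, inferInstance, T, bag, hT, hbag, (Set.iUnion_subset fun b y hy => ?_).antisymm h₁,
        hconn⟩
      refine ⟨h₂ (Set.mem_iUnion.2 ⟨b, hy⟩), fun hyu => ?_⟩
      have : b ∈ {b | bag b = {u}} := (hbag b).eq_singleton_of_mem (Set.mem_singleton_iff.1 hyu ▸ hy)
      simp [hn] at this
    | succ n ih =>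
      intro bag hbag h₁ h₂ hconn hn
      obtain ⟨b₀, hb₀⟩ : {b | bag b = {u}}.Nonempty := by
        rw [← Set.ncard_pos]
        omega
      obtain ⟨c₀, hc₀⟩ := Set.mem_iUnion.1 (h₁ ⟨ha, hne⟩)
      obtain ⟨b, c, -, ⟨hbc, -, huc⟩, -, hb, hc⟩ := exists_arc_into (R := {b | bag b ≠ {u}})
        (hconn u b₀ c₀ (subset_reach D _ (hb₀.symm ▸ rfl : u ∈ bag b₀)) ⟨a, hc₀, hau⟩) (by simpa using hb₀)
        (by rintro h; rw [h] at hc₀; exact hne hc₀)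
      simp only [Set.mem_ofPred_eq, not_not] at hb
      have hle : reach D (bag b) ⊆ reach D (bag c) := fun y ⟨s, hs, hy⟩ => by
        rw [hb, Set.mem_singleton_iff] at hs
        exact mem_reach_of_reflTransGen huc (hs ▸ hy)
      have hcb : c ≠ b := hbc.ne'
      refine ih (Function.update bag b (bag c)) (fun d => ?_) (fun y hy => ?_) ?_
        (fun x d₁ d₂ hd₁ hd₂ => ?_) ?_
      · by_cases hd : d = b
        · subst hd; simpa using hbag c
        · simpa [hd] using hbag d
      · obtain ⟨d, hd⟩ := Set.mem_iUnion.1 (h₁ hy)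
        refine Set.mem_iUnion.2 ⟨d, ?_⟩
        rw [Function.update_of_ne]
        · exact hd
        · rintro rfl
          rw [hb] at hd
          exact hy.2 hd
      · refine Set.iUnion_subset fun d => ?_
        by_cases hd : d = b
        · subst hd
          simpa using (Set.subset_iUnion bag c).trans h₂
        · simpa [hd] using (Set.subset_iUnion bag d).trans h₂
      · have hmono : ∀ d, reach D (bag d) ⊆ reach D (Function.update bag b (bag c) d) := fun d => by
          by_cases hd : d = b
          · subst hd; simpa using hle
          · simp [hd]
        by_cases hx : x ∈ reach D (bag c)
        · -- The node `b` joins the support of `x` as a neighbour of `c`.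
          have hxc : x ∈ reach D (Function.update bag b (bag c) c) := by simpa [hcb] using hx
          have hxb : x ∈ reach D (Function.update bag b (bag c) b) := by simpa using hx
          have toc : ∀ d, x ∈ reach D (Function.update bag b (bag c) d) →
              ReflTransGen (fun a₁ a₂ => T.Adj a₁ a₂ ∧
                x ∈ reach D (Function.update bag b (bag c) a₁) ∧
                x ∈ reach D (Function.update bag b (bag c) a₂)) d c := by
            intro d hd
            by_cases hdb : d = b
            · subst hdb
              exact .single ⟨hbc, hxb, hxc⟩
            · refine (hconn x d c (by simpa [hdb] using hd) hx).lift id fun a₁ a₂ h => ?_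
              exact ⟨h.1, hmono _ h.2.1, hmono _ h.2.2⟩
          exact (toc d₁ hd₁).trans (reflTransGen_symm (fun _ _ h => ⟨h.1.symm, h.2.2, h.2.1⟩)
            (toc d₂ hd₂))
        · have heq : ∀ d, x ∈ reach D (Function.update bag b (bag c) d) → x ∈ reach D (bag d) := by
            intro d hd
            by_cases hdb : d = b
            · subst hdb
              exact absurd (by simpa using hd) hx
            · simpa [hdb] using hd
          exact (hconn x d₁ d₂ (heq _ hd₁) (heq _ hd₂)).lift id fun a₁ a₂ h =>
            ⟨h.1, hmono _ h.2.1, hmono _ h.2.2⟩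
      · have : {d | Function.update bag b (bag c) d = {u}} = {d | bag d = {u}} \ {b} := by
          ext d
          by_cases hdb : d = b
          · subst hdb; simpa using hc
          · simp [hdb]
        rw [this, Set.ncard_sdiff_singleton_of_mem (by exact hb), hn, Nat.add_sub_cancel]
  exact key _ bag hbag (hcov ▸ Set.sdiff_subset) hcov.subset hconn rfl

end JoinTrees

/-! ### Graphs without long induced cycles -/

section NoLongInducedCycle

variable {V : Type u₁}

open Relation

theorem reach_sources_eq_univ [Finite V] {D : Digraph V} (hD : IsDAG D) :
    reach D (sources D) = Set.univ := by
  have hwf : WellFounded (TransGen D.Adj) :=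
    have : Std.Irrefl (TransGen D.Adj) := ⟨hD⟩
    Finite.wellFounded_of_trans_of_irrefl _
  refine Set.eq_univ_of_forall fun v => ?_
  induction v using hwf.induction with
  | _ v ih =>
    by_cases hv : v ∈ sources D
    · exact subset_reach D _ hv
    · obtain ⟨w, hw⟩ : ∃ w, D.Adj w v := by simpa [sources] using hv
      exact mem_reach_of_reflTransGen (ih w (.single hw)) (.single hw)

/-- Kruskal's algorithm: there is a spanning tree of the complete graph in which all edges of the
path between `i` and `j` have at least the weight of the pair `i`, `j`. -/
theorem exists_isTree_weight_le {ι : Type*} [Finite ι] [Nonempty ι] (w : ι → ι → ℕ)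
    (hw : ∀ a b, w a b = w b a) :
    ∃ T : SimpleGraph ι, T.IsTree ∧ ∀ (i j : ι) (p : T.Walk i j), p.IsPath →
      ∀ a b, s(a, b) ∈ p.edges → w i j ≤ w a b := by
  let G : ℕ → SimpleGraph ι := fun t =>
    { Adj := fun a b => a ≠ b ∧ t ≤ w a b
      symm := ⟨fun a b h => ⟨h.1.symm, hw a b ▸ h.2⟩⟩
      loopless := ⟨fun a h => h.1 rfl⟩ }
  obtain ⟨N, hN⟩ : ∃ N, ∀ a b, w a b < N := by
    obtain ⟨M, hM⟩ := (Set.finite_range fun q : ι × ι => w q.1 q.2).bddAbove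
    exact ⟨M + 1, fun a b => Nat.lt_succ_of_le (hM ⟨(a, b), rfl⟩)⟩
  -- A forest in `G (N - m)` that contains spanning forests of all `G t` with `t ≥ N - m`.
  have key : ∀ m, ∃ F : SimpleGraph ι, F.IsAcyclic ∧ F ≤ G (N - m) ∧
      ∀ i j, i ≠ j → N - m ≤ w i j → (F ⊓ G (w i j)).Reachable i j := by
    intro m
    induction m with
    | zero => exact ⟨⊥, SimpleGraph.isAcyclic_bot, bot_le, fun i j _ h => absurd h (hN i j).not_ge⟩
    | succ m ih =>
      obtain ⟨F, hF, hFG, hreach⟩ := ih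
      have hle : G (N - m) ≤ G (N - (m + 1)) := fun a b h => ⟨h.1, le_trans (by omega) h.2⟩
      obtain ⟨F', hFF', hF'G, hF', heq⟩ :=
        SimpleGraph.exists_isAcyclic_reachable_eq_le_of_le_of_isAcyclic (hFG.trans hle) hF
      refine ⟨F', hF', hF'G, fun i j hij hwij => ?_⟩
      by_cases h : N - m ≤ w i j
      · exact (hreach i j hij h).mono (inf_le_inf_right _ hFF')
      · have hN' : w i j = N - (m + 1) := by omega
        rw [hN', inf_eq_left.2 hF'G, heq]
        exact SimpleGraph.Adj.reachable (G := G (N - (m + 1))) ⟨hij, hwij⟩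
  obtain ⟨T, hT, -, hreach⟩ := key N
  rw [Nat.sub_self] at hreach
  refine ⟨T, ⟨⟨fun i j => ?_⟩, hT⟩, fun i j p hp a b hab => ?_⟩
  · by_cases hij : i = j
    · exact hij ▸ .refl _
    · exact (hreach i j hij (Nat.zero_le _)).mono inf_le_left
  · by_cases hij : i = j
    · subst hij
      simp [(SimpleGraph.Walk.isPath_iff_nil.1 hp).eq_nil] at hab
    · obtain ⟨q, hq⟩ := (hreach i j hij (Nat.zero_le _)).exists_isPath
      have hpq : p = q.mapLe inf_le_left :=
        congrArg Subtype.val ((hT.subsingleton_path i j).elim ⟨p, hp⟩ ⟨_, hq.mapLe inf_le_left⟩)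
      rw [hpq, SimpleGraph.Walk.edges_mapLe_eq_edges] at hab
      exact (q.adj_of_mem_edges hab).2.2

theorem reflTransGen_of_walk {ι : Type*} {T : SimpleGraph ι} {r : V → V → Prop} (f : ι → V)
    {i j : ι} (p : T.Walk i j) (h : ∀ a b, s(a, b) ∈ p.edges → ReflTransGen r (f a) (f b)) :
    ReflTransGen r (f i) (f j) := by
  induction p with
  | nil => exact .refl
  | cons hadj p ih =>
    exact (h _ _ (by simp)).trans (ih fun a b hab => h a b (by simp [hab]))

/-- An orientation of a graph without induced cycles of length at least six has DAG-treewidth one: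
a spanning tree on the sources of maximum weight, the weight of a pair being the number of its
common descendants, is a join tree. Otherwise some `x` is reachable from the ends `i` and `j` of a
tree path, but from no node inside the path. As each edge of the path weighs at least as much as the
pair `i`, `j`, its ends have a common descendant that is not a common descendant of `i` and `j`. By
way of these, `i` and `j` are connected outside the common descendants of `i` and `j`, and there is
a long induced cycle. -/
theorem hasJoinTree_sources [Finite V] {D : Digraph V} {G : SimpleGraph V}
    (hD : ∀ a b, G.Adj a b ↔ (D.Adj a b ∨ D.Adj b a))
    (hG : ∀ n, 6 ≤ n → IsEmpty (SimpleGraph.cycleGraph n ↪g G)) (hne : (sources D).Nonempty) :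
    HasJoinTree D (sources D) := by
  classical
  have := hne.to_subtype
  obtain ⟨n, ⟨e⟩⟩ := Finite.exists_equiv_fin (sources D)
  have : Nonempty (Fin n) := ⟨e ⟨_, hne.some_mem⟩⟩
  let f : Fin n → V := fun i => e.symm i
  have hf : Function.Injective f := Subtype.val_injective.comp e.symm.injective
  have hfs : ∀ i, f i ∈ sources D := fun i => (e.symm i).2
  let E : Fin n → Set V := fun i => reach D {f i}
  have hE : ∀ i v, v ∈ E i ↔ ReflTransGen D.Adj (f i) v := fun i v => mem_reach_singleton
  have hsrc : ∀ i j, i ≠ j → f i ∉ E j := fun i j hij h => by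
    rcases ReflTransGen.cases_tail ((hE _ _).1 h) with h | ⟨w, -, hw⟩
    · exact hij (hf h)
    · exact hfs i w hw
  obtain ⟨T, hT, hTw⟩ := exists_isTree_weight_le (fun i j => (E i ∩ E j).ncard)
    fun a b => by simp only [Set.inter_comm]
  refine ⟨Fin n, inferInstance, T, fun i => {f i}, hT, fun i => Set.subsingleton_singleton, ?_,
    (hasConnectedSupports_iff hT _).2 ?_⟩
  · ext v
    simp only [Set.mem_iUnion, Set.mem_singleton_iff]
    exact ⟨fun ⟨i, hi⟩ => hi ▸ hfs i, fun hv => ⟨e ⟨v, hv⟩, by simp [f]⟩⟩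
  change ∀ (i j b : Fin n) (p : T.Walk i j), p.IsPath → b ∈ p.support → E i ∩ E j ⊆ E b
  suffices H : ∀ (m : ℕ) (i j b : Fin n) (p : T.Walk i j), p.length ≤ m → p.IsPath →
      b ∈ p.support → E i ∩ E j ⊆ E b from fun i j b p => H p.length i j b p le_rfl
  intro m
  induction m with
  | zero =>
    intro i j b p hm hp hb x hx
    cases p with
    | nil => simp only [SimpleGraph.Walk.support_nil, List.mem_singleton] at hb; exact hb ▸ hx.1
    | cons _ _ => simp at hm
  | succ m ih =>
    intro i j b p hm hp hb x hx
    by_cases hbi : b = i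
    · exact hbi ▸ hx.1
    by_cases hbj : b = j
    · exact hbj ▸ hx.2
    suffices ∃ k ∈ p.support, k ≠ i ∧ k ≠ j ∧ x ∈ E k by
      obtain ⟨k, hk, hki, hkj, hxk⟩ := this
      have hlen := congrArg SimpleGraph.Walk.length (p.take_spec hk)
      rw [SimpleGraph.Walk.length_append] at hlen
      have h1 : (p.takeUntil k hk).length ≠ 0 := fun h =>
        hki (SimpleGraph.Walk.eq_of_length_eq_zero h).symm
      have h2 : (p.dropUntil k hk).length ≠ 0 := fun h =>
        hkj (SimpleGraph.Walk.eq_of_length_eq_zero h)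
      rw [← p.take_spec hk, SimpleGraph.Walk.mem_support_append_iff] at hb
      rcases hb with hb | hb
      · exact ih i k b _ (by omega) (hp.takeUntil hk) hb ⟨hx.1, hxk⟩
      · exact ih k j b _ (by omega) (hp.dropUntil hk) hb ⟨hxk, hx.2⟩
    by_contra hno
    have hno' : ∀ k ∈ p.support, x ∈ E k → k = i ∨ k = j := fun k hk hxk => by
      by_contra hcon
      exact hno ⟨k, hk, fun h => hcon (.inl h), fun h => hcon (.inr h), hxk⟩
    have hij : i ≠ j := by
      rintro rfl
      simp only [(SimpleGraph.Walk.isPath_iff_nil.1 hp).eq_nil,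
        SimpleGraph.Walk.support_nil, List.mem_singleton] at hb
      exact hbi hb
    -- The node `b` lies strictly inside the path, so the path is not a single edge.
    have hnadj : ¬ T.Adj i j := fun h => by
      have heq := (hT.existsUnique_path i j).unique hp (SimpleGraph.Path.singleton h).2
      rw [heq] at hb
      simp [SimpleGraph.Path.singleton, hbi, hbj] at hb
    have hstep : ∀ a b, s(a, b) ∈ p.edges → ∃ y, y ∈ E a ∧ y ∈ E b ∧ y ∉ E i ∩ E j := by
      intro a b hab
      by_contra hcon
      have hsub : E a ∩ E b ⊆ E i ∩ E j := fun y hy => by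
        by_contra hy'
        exact hcon ⟨y, hy.1, hy.2, hy'⟩
      have hxab : x ∈ E a ∩ E b := by
        rw [Set.eq_of_subset_of_ncard_le hsub (hTw i j p hp a b hab)]
        exact hx
      have hadj := p.adj_of_mem_edges hab
      have ha := hno' a (p.fst_mem_support_of_mem_edges hab) hxab.1
      have hb := hno' b (p.snd_mem_support_of_mem_edges hab) hxab.2
      rcases ha with rfl | rfl <;> rcases hb with rfl | rfl
      · exact hadj.ne rfl
      · exact hnadj hadj
      · exact hnadj hadj.symm
      · exact hadj.ne rfl
    obtain ⟨N, hN, ⟨c⟩⟩ := exists_long_induced_cycle hD (P := f '' {k | k ∈ p.support})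
      ⟨i, p.start_mem_support, rfl⟩ ⟨j, p.end_mem_support, rfl⟩
      ((hE _ _).1 hx.1) ((hE _ _).1 hx.2)
      (by
        rintro _ ⟨k, hk, rfl⟩ hkx
        exact (hno' k hk ((hE _ _).2 hkx)).imp (congrArg f) (congrArg f))
      (fun h => hsrc i j hij h.2) (fun h => hsrc j i hij.symm h.1)
      (by
        refine reflTransGen_of_walk f p fun a b hab => ?_
        obtain ⟨y, hya, hyb, hy⟩ := hstep a b hab
        have hpath : ∀ k ∈ p.support, y ∈ E k → ReflTransGen (fun a b => G.Adj a b ∧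
            a ∈ reach D (f '' {k | k ∈ p.support}) \ (E i ∩ E j) ∧
            b ∈ reach D (f '' {k | k ∈ p.support}) \ (E i ∩ E j)) (f k) y := by
          intro k hk hyk
          refine reflTransGen_within (fun a b h => (hD a b).2 (.inl h)) ((hE _ _).1 hyk)
            fun v h1 h2 => ⟨⟨f k, ⟨k, hk, rfl⟩, h1⟩, fun hv => hy ?_⟩
          exact ⟨mem_reach_of_reflTransGen hv.1 h2, mem_reach_of_reflTransGen hv.2 h2⟩
        exact (hpath a (p.fst_mem_support_of_mem_edges hab) hya).trans
          (reflTransGen_symm (fun _ _ h => ⟨h.1.symm, h.2.2, h.2.1⟩)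
            (hpath b (p.snd_mem_support_of_mem_edges hab) hyb)))
    exact (hG N hN).false c

theorem isEmpty_cycleGraph_embedding_of_licl_lt [Finite V] {G : SimpleGraph V} {m : ℕ}
    (hG : licl G < m) {n : ℕ} (hn : m ≤ n) (hn3 : 3 ≤ n) :
    IsEmpty (SimpleGraph.cycleGraph n ↪g G) := by
  rw [← not_nonempty_iff]
  intro h
  refine absurd (le_csSup ⟨Nat.card V, ?_⟩ (⟨hn3, h⟩ :
    n ∈ {n | 3 ≤ n ∧ Nonempty (SimpleGraph.cycleGraph n ↪g G)})) (hG.trans_le hn).not_ge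
  rintro k ⟨-, ⟨c⟩⟩
  simpa using Nat.card_le_card_of_injective c c.injective

end NoLongInducedCycle

/-! ### Reachability in a gluing of two directed acyclic graphs -/

section GluedReachability

variable {V : Type u₁} {V' : Type u₂} {W : Type u₃}

open Relation

/-- `D''` is the gluing of the directed acyclic graphs `D` and `D'`, embedded by `f` and `f'`, along
the vertices `u`, `u'` (then `u = v` and `u' = v'`) or along the arcs `u → v`, `u' → v'`. -/
structure DagGluing (D : Digraph V) (D' : Digraph V') (D'' : Digraph W) (f : V ↪ W) (f' : V' ↪ W)
    (u v : V) (u' v' : V') : Prop where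
  isDAG_left : IsDAG D
  isDAG_right : IsDAG D'
  cover : Set.range f ∪ Set.range f' = Set.univ
  glue : ∀ x y, f x = f' y ↔ ((x = u ∧ y = u') ∨ (x = v ∧ y = v'))
  adj : ∀ a b, D''.Adj a b ↔ (Relation.Map D.Adj f f a b ∨ Relation.Map D'.Adj f' f' a b)
  link : (u = v ∧ u' = v') ∨ (D.Adj u v ∧ D'.Adj u' v')

variable {D : Digraph V} {D' : Digraph V'} {D'' : Digraph W} {f : V ↪ W} {f' : V' ↪ W}
  {u v : V} {u' v' : V'}

namespace DagGluing

theorem symm (g : DagGluing D D' D'' f f' u v u' v') : DagGluing D' D D'' f' f u' v' u v where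
  isDAG_left := g.isDAG_right
  isDAG_right := g.isDAG_left
  cover := by rw [Set.union_comm, g.cover]
  glue x y := by rw [eq_comm, g.glue, and_comm, @and_comm (y = v)]
  adj a b := by rw [g.adj, or_comm]
  link := g.link.imp And.symm And.symm

theorem eq_or_eq (g : DagGluing D D' D'' f f' u v u' v') (w : W) :
    (∃ x, w = f x) ∨ ∃ y, w = f' y := by
  have : w ∈ Set.range f ∪ Set.range f' := g.cover ▸ Set.mem_univ w
  exact this.imp (fun ⟨x, h⟩ => ⟨x, h.symm⟩) (fun ⟨x, h⟩ => ⟨x, h.symm⟩)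

theorem reach_link (g : DagGluing D D' D'' f f' u v u' v') : ReflTransGen D.Adj u v := by
  rcases g.link with ⟨rfl, -⟩ | ⟨h, -⟩
  exacts [.refl, .single h]

theorem map_eq (g : DagGluing D D' D'' f f' u v u' v') : f u = f' u' :=
  (g.glue u u').2 (.inl ⟨rfl, rfl⟩)

theorem map_eq' (g : DagGluing D D' D'' f f' u v u' v') : f v = f' v' :=
  (g.glue v v').2 (.inr ⟨rfl, rfl⟩)

theorem reach_map (g : DagGluing D D' D'' f f' u v u' v') {x y : V}
    (h : ReflTransGen D.Adj x y) : ReflTransGen D''.Adj (f x) (f y) :=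
  h.lift f fun a b hab => (g.adj _ _).2 (.inl ⟨a, b, hab, rfl, rfl⟩)

/-- Directed paths of positive length out of `V`: if they end in `V`, their ends are joined by such a
path inside `V`, and if they end in `V'`, they can be taken to cross from `V` to `V'` once. -/
theorem of_transGen (g : DagGluing D D' D'' f f' u v u' v') {x : V} {b : W}
    (h : TransGen D''.Adj (f x) b) :
    (∀ y, b = f y → TransGen D.Adj x y) ∧
      (∀ y, b = f' y → (ReflTransGen D.Adj x u ∧ ReflTransGen D'.Adj u' y) ∨
        (ReflTransGen D.Adj x v ∧ ReflTransGen D'.Adj v' y)) := by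
  have step : ∀ c b : W, ((∀ y, c = f y → ReflTransGen D.Adj x y) ∧
      (∀ y, c = f' y → (ReflTransGen D.Adj x u ∧ ReflTransGen D'.Adj u' y) ∨
        (ReflTransGen D.Adj x v ∧ ReflTransGen D'.Adj v' y))) → D''.Adj c b →
      (∀ y, b = f y → TransGen D.Adj x y) ∧
      (∀ y, b = f' y → (ReflTransGen D.Adj x u ∧ ReflTransGen D'.Adj u' y) ∨
        (ReflTransGen D.Adj x v ∧ ReflTransGen D'.Adj v' y)) := by
    rintro c b ⟨h1, h2⟩ hcb
    rcases (g.adj c b).1 hcb with ⟨y, z, hyz, rfl, rfl⟩ | ⟨y, z, hyz, rfl, rfl⟩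
    · have hxz : TransGen D.Adj x z := TransGen.tail' (h1 y rfl) hyz
      refine ⟨fun w hw => f.injective hw ▸ hxz, fun w hw => ?_⟩
      rcases (g.glue z w).1 hw with ⟨rfl, rfl⟩ | ⟨rfl, rfl⟩
      · exact .inl ⟨hxz.to_reflTransGen, .refl⟩
      · exact .inr ⟨hxz.to_reflTransGen, .refl⟩
    · refine ⟨fun w hw => ?_, fun w hw => ?_⟩
      · rcases h2 y rfl with ⟨hxu, huy⟩ | ⟨hxv, hvy⟩
        · have huz : TransGen D'.Adj u' z := TransGen.tail' huy hyz
          rcases (g.glue w z).1 hw.symm with ⟨rfl, rfl⟩ | ⟨rfl, rfl⟩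
          · exact absurd huz (g.isDAG_right _)
          · rcases g.link with ⟨-, rfl⟩ | ⟨huv, -⟩
            · exact absurd huz (g.isDAG_right _)
            · exact TransGen.tail' hxu huv
        · have hvz : TransGen D'.Adj v' z := TransGen.tail' hvy hyz
          rcases (g.glue w z).1 hw.symm with ⟨rfl, rfl⟩ | ⟨rfl, rfl⟩
          · rcases g.link with ⟨-, rfl⟩ | ⟨-, huv⟩
            · exact absurd hvz (g.isDAG_right _)
            · exact absurd (hvz.tail huv) (g.isDAG_right _)
          · exact absurd hvz (g.isDAG_right _)
      · rw [← f'.injective hw]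
        exact (h2 y rfl).imp (fun h => ⟨h.1, h.2.tail hyz⟩) fun h => ⟨h.1, h.2.tail hyz⟩
  induction h with
  | single h =>
    refine step _ _ ⟨fun y hy => f.injective hy ▸ .refl, fun y hy => ?_⟩ h
    rcases (g.glue x y).1 hy with ⟨rfl, rfl⟩ | ⟨rfl, rfl⟩
    · exact .inl ⟨.refl, .refl⟩
    · exact .inr ⟨.refl, .refl⟩
  | tail _ hbc ih => exact step _ _ ⟨fun y hy => (ih.1 y hy).to_reflTransGen, ih.2⟩ hbc

theorem isDAG (g : DagGluing D D' D'' f f' u v u' v') : IsDAG D'' := by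
  intro w hw
  rcases g.eq_or_eq w with ⟨x, rfl⟩ | ⟨x, rfl⟩
  · exact g.isDAG_left x ((g.of_transGen hw).1 x rfl)
  · exact g.isDAG_right x ((g.symm.of_transGen hw).1 x rfl)

theorem reach_left_iff (g : DagGluing D D' D'' f f' u v u' v') {x y : V} :
    ReflTransGen D''.Adj (f x) (f y) ↔ ReflTransGen D.Adj x y := by
  refine ⟨fun h => ?_, g.reach_map⟩
  rcases reflTransGen_iff_eq_or_transGen.1 h with h | h
  · exact f.injective h ▸ .refl
  · exact ((g.of_transGen h).1 y rfl).to_reflTransGen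

theorem reach_cross_iff (g : DagGluing D D' D'' f f' u v u' v') {x : V} {y : V'} :
    ReflTransGen D''.Adj (f x) (f' y) ↔
      ((ReflTransGen D.Adj x u ∧ ReflTransGen D'.Adj u' y) ∨
        (ReflTransGen D.Adj x v ∧ ReflTransGen D'.Adj v' y)) := by
  refine ⟨fun h => ?_, ?_⟩
  · rcases reflTransGen_iff_eq_or_transGen.1 h with h | h
    · rcases (g.glue x y).1 h.symm with ⟨rfl, rfl⟩ | ⟨rfl, rfl⟩
      · exact .inl ⟨.refl, .refl⟩
      · exact .inr ⟨.refl, .refl⟩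
    · exact (g.of_transGen h).2 y rfl
  · rintro (⟨h1, h2⟩ | ⟨h1, h2⟩)
    · exact (g.reach_map h1).trans (g.map_eq ▸ g.symm.reach_map h2)
    · exact (g.reach_map h1).trans (g.map_eq' ▸ g.symm.reach_map h2)

/-- What is reachable from both sides is reachable from the merged vertex `u`. -/
theorem reach_of_both (g : DagGluing D D' D'' f f' u v u' v') {x : V} {y : V'} {w : W}
    (hx : ReflTransGen D''.Adj (f x) w) (hy : ReflTransGen D''.Adj (f' y) w) :
    ReflTransGen D''.Adj (f u) w := by
  rcases g.eq_or_eq w with ⟨z, rfl⟩ | ⟨z, rfl⟩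
  · rcases g.symm.reach_cross_iff.1 hy with ⟨-, h⟩ | ⟨-, h⟩
    · exact g.reach_map h
    · exact g.reach_map (g.reach_link.trans h)
  · rw [g.map_eq]
    rcases g.reach_cross_iff.1 hx with ⟨-, h⟩ | ⟨-, h⟩
    · exact g.symm.reach_map h
    · exact g.symm.reach_map (g.symm.reach_link.trans h)

/-- Seen from `V`, every vertex of the gluing behaves like a vertex of `D`, namely itself or the last
merged vertex from which it is reachable, or is not reachable at all. -/
theorem exists_pullback (g : DagGluing D D' D'' f f' u v u' v') :
    ∃ ρ : W → Option V,
      (∀ (B : Set V) (y : W), y ∈ reach D'' (f '' B) ↔ ∃ z ∈ ρ y, z ∈ reach D B) ∧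
      (∀ x, ρ (f x) = some x) ∧
      (∀ y, ∀ z ∈ ρ (f' y), (z = u ∨ z = v) ∧ ReflTransGen D'.Adj u' y) := by
  have key : ∀ y : W, ∃ o : Option V,
      (∀ x, ReflTransGen D''.Adj (f x) y ↔ ∃ z ∈ o, ReflTransGen D.Adj x z) ∧
      (∀ x, y = f x → o = some x) ∧
      (∀ y', y = f' y' → ∀ z ∈ o, (z = u ∨ z = v) ∧ ReflTransGen D'.Adj u' y') := by
    intro y
    by_cases hy : ∃ x, y = f x
    · obtain ⟨x, rfl⟩ := hy
      refine ⟨some x, fun x => by simp [g.reach_left_iff], fun z hz => by simpa using hz,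
        fun y' hy' z hz => ?_⟩
      obtain rfl : x = z := by simpa using hz
      rcases (g.glue x y').1 hy' with ⟨rfl, rfl⟩ | ⟨rfl, rfl⟩
      · exact ⟨.inl rfl, .refl⟩
      · exact ⟨.inr rfl, g.symm.reach_link⟩
    · obtain ⟨y', rfl⟩ := (g.eq_or_eq y).resolve_left hy
      have hno : ∀ (o : Option V) (x : V), f' y' = f x → o = some x :=
        fun _ x h => absurd ⟨x, h⟩ hy
      by_cases hv : ReflTransGen D'.Adj v' y'
      · refine ⟨some v, fun x => ?_, hno _, fun w hw z hz => ?_⟩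
        · simp only [g.reach_cross_iff, Option.mem_def, Option.some.injEq, exists_eq_left', hv,
            and_true]
          exact ⟨fun h => h.elim (fun h => h.1.trans g.reach_link) id, .inr⟩
        · rw [← f'.injective hw]
          exact ⟨.inr (by simpa using hz.symm), g.symm.reach_link.trans hv⟩
      · by_cases hu : ReflTransGen D'.Adj u' y'
        · refine ⟨some u, fun x => by simp [g.reach_cross_iff, hv, hu], hno _, fun w hw z hz => ?_⟩
          rw [← f'.injective hw]
          exact ⟨.inl (by simpa using hz.symm), hu⟩
        · exact ⟨none, fun x => by simp [g.reach_cross_iff, hv, hu], hno _, by simp⟩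
  choose ρ h1 h2 h3 using key
  refine ⟨ρ, fun B y => ?_, fun x => h2 _ x rfl, fun y => h3 _ y rfl⟩
  constructor
  · rintro ⟨_, ⟨x, hx, rfl⟩, h⟩
    obtain ⟨z, hz, h⟩ := (h1 y x).1 h
    exact ⟨z, hz, x, hx, h⟩
  · rintro ⟨z, hz, x, hx, h⟩
    exact ⟨f x, ⟨x, hx, rfl⟩, (h1 y x).2 ⟨z, hz, h⟩⟩

theorem mem_sources_iff (g : DagGluing D D' D'' f f' u v u' v') {x : V} :
    f x ∈ sources D'' ↔ x ∈ sources D ∧ ∀ y, f x = f' y → y ∈ sources D' := by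
  constructor
  · intro h
    refine ⟨fun w hw => h (f w) ((g.adj _ _).2 (.inl ⟨w, x, hw, rfl, rfl⟩)), fun y hy w hw => ?_⟩
    exact h (f' w) ((g.adj _ _).2 (.inr ⟨w, y, hw, rfl, hy.symm⟩))
  · rintro ⟨h1, h2⟩ w hw
    rcases (g.adj _ _).1 hw with ⟨a, b, hab, rfl, hb⟩ | ⟨a, b, hab, rfl, hb⟩
    · exact h1 a (f.injective hb ▸ hab)
    · exact h2 b hb.symm a hab

theorem sources_subset (g : DagGluing D D' D'' f f' u v u' v') :
    sources D'' ⊆ f '' sources D ∪ f' '' sources D' := by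
  intro w hw
  rcases g.eq_or_eq w with ⟨x, rfl⟩ | ⟨x, rfl⟩
  · exact .inl ⟨x, (g.mem_sources_iff.1 hw).1, rfl⟩
  · exact .inr ⟨x, (g.symm.mem_sources_iff.1 hw).1, rfl⟩

/-- Only the merged vertex `u` can be a source on one side and not in the gluing. -/
theorem eq_of_notMem_sources (g : DagGluing D D' D'' f f' u v u' v') {x : V} (hx : x ∈ sources D)
    (h : f x ∉ sources D'') : x = u ∧ u' ∉ sources D' := by
  rw [g.mem_sources_iff] at h
  push Not at h
  obtain ⟨y, hy, hys⟩ := h hx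
  rcases (g.glue x y).1 hy with ⟨rfl, rfl⟩ | ⟨rfl, rfl⟩
  · exact ⟨rfl, hys⟩
  · rcases g.link with ⟨rfl, rfl⟩ | ⟨h, -⟩
    · exact ⟨rfl, hys⟩
    · exact absurd h (hx u)

end DagGluing

end GluedReachability

/-! ### Join trees of a gluing -/

section GluedJoinTrees

variable {V : Type u₁} {V' : Type u₂} {W : Type u₃}

open Relation

theorem isTree_sum_sup_edge {ι κ : Type*} [Finite ι] [Finite κ] {T : SimpleGraph ι}
    {T' : SimpleGraph κ} (hT : T.IsTree) (hT' : T'.IsTree) (a : ι) (b : κ) :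
    ((T ⊕g T') ⊔ SimpleGraph.edge (.inl a) (.inr b)).IsTree := by
  have hconn : ((T ⊕g T') ⊔ SimpleGraph.edge (.inl a) (.inr b)).Connected :=
    hT.connected.sum_sup_edge hT'.connected
  -- A connected graph has enough edges to be a tree, so an upper bound for their number suffices.
  refine SimpleGraph.isTree_iff_connected_and_card.2
    ⟨hconn, le_antisymm ?_ hconn.card_vert_le_card_edgeSet_add_one⟩
  have h1 := (SimpleGraph.isTree_iff_connected_and_card.1 hT).2
  have h2 := (SimpleGraph.isTree_iff_connected_and_card.1 hT').2
  have h3 : Nat.card (T ⊕g T').edgeSet = Nat.card T.edgeSet + Nat.card T'.edgeSet := by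
    rw [Nat.card_congr SimpleGraph.edgeSetSumEquiv, Nat.card_sum]
  have h4 : Nat.card ((T ⊕g T') ⊔ SimpleGraph.edge (.inl a) (.inr b)).edgeSet ≤
      Nat.card (T ⊕g T').edgeSet + 1 := by
    rw [SimpleGraph.edgeSet_sup, Nat.card_coe_set_eq, Nat.card_coe_set_eq]
    refine (Set.ncard_union_le _ _).trans (Nat.add_le_add_left ?_ _)
    rw [SimpleGraph.edge, SimpleGraph.edgeSet_fromEdgeSet]
    exact (Set.ncard_le_ncard Set.sdiff_subset).trans (Set.ncard_singleton _).le
  rw [Nat.card_sum]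
  omega

variable {D : Digraph V} {D' : Digraph V'} {D'' : Digraph W} {f : V ↪ W} {f' : V' ↪ W}
  {u v : V} {u' v' : V'}

theorem DagGluing.hasConnectedSupports_image (g : DagGluing D D' D'' f f' u v u' v') {ι : Type*}
    {T : SimpleGraph ι} {bag : ι → Set V} (h : HasConnectedSupports T fun b => reach D (bag b)) :
    HasConnectedSupports T fun b => reach D'' (f '' bag b) := by
  obtain ⟨ρ, hρ, -, -⟩ := g.exists_pullback
  intro y b₁ b₂ h₁ h₂
  simp only [hρ] at h₁ h₂ ⊢
  obtain ⟨x, hx, hx₁⟩ := h₁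
  obtain ⟨x', hx', hx₂⟩ := h₂
  obtain rfl := Option.mem_unique hx hx'
  exact (h x b₁ b₂ hx₁ hx₂).lift id fun a b hab => ⟨hab.1, ⟨x, hx, hab.2.1⟩, ⟨x, hx, hab.2.2⟩⟩

theorem DagGluing.hasJoinTree_image (g : DagGluing D D' D'' f f' u v u' v') {S : Set V}
    (h : HasJoinTree D S) : HasJoinTree D'' (f '' S) := by
  obtain ⟨ι, hι, T, bag, hT, hbag, hcov, hconn⟩ := h
  exact ⟨ι, hι, T, fun b => f '' bag b, hT, fun b => (hbag b).image f,
    by rw [← Set.image_iUnion, hcov], g.hasConnectedSupports_image hconn⟩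

/-- Join trees on both sides are joined by an edge between two nodes whose bags reach the merged
vertex `u`. -/
theorem DagGluing.hasJoinTree_union (g : DagGluing D D' D'' f f' u v u' v') {S : Set V}
    {S' : Set V'} (h : HasJoinTree D S) (h' : HasJoinTree D' S') (hu : u ∈ reach D S)
    (hu' : u' ∈ reach D' S') : HasJoinTree D'' (f '' S ∪ f' '' S') := by
  obtain ⟨ι, _, T, bag, hT, hbag, hcov, hconn⟩ := h
  obtain ⟨ι', _, T', bag', hT', hbag', hcov', hconn'⟩ := h'
  obtain ⟨a, hau⟩ : ∃ a, u ∈ reach D (bag a) := by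
    obtain ⟨s, hs, hsu⟩ := hu
    obtain ⟨a, ha⟩ := Set.mem_iUnion.1 (hcov ▸ hs)
    exact ⟨a, s, ha, hsu⟩
  obtain ⟨a', hau'⟩ : ∃ a', u' ∈ reach D' (bag' a') := by
    obtain ⟨s, hs, hsu⟩ := hu'
    obtain ⟨a, ha⟩ := Set.mem_iUnion.1 (hcov' ▸ hs)
    exact ⟨a, s, ha, hsu⟩
  have hfa : f u ∈ reach D'' (f '' bag a) :=
    let ⟨s, hs, hsu⟩ := hau
    ⟨f s, ⟨s, hs, rfl⟩, g.reach_map hsu⟩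
  have hfa' : f u ∈ reach D'' (f' '' bag' a') :=
    let ⟨s, hs, hsu⟩ := hau'
    ⟨f' s, ⟨s, hs, rfl⟩, g.map_eq ▸ g.symm.reach_map hsu⟩
  have hcl := g.hasConnectedSupports_image hconn
  have hcr := g.symm.hasConnectedSupports_image hconn'
  have hleft : ∀ (x : W) (b₁ b₂ : ι), x ∈ reach D'' (f '' bag b₁) → x ∈ reach D'' (f '' bag b₂) →
      ReflTransGen (fun c d => ((T ⊕g T') ⊔ SimpleGraph.edge (.inl a) (.inr a')).Adj c d ∧
        x ∈ reach D'' (Sum.elim (fun b => f '' bag b) (fun b => f' '' bag' b) c) ∧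
        x ∈ reach D'' (Sum.elim (fun b => f '' bag b) (fun b => f' '' bag' b) d))
        (.inl b₁) (.inl b₂) := fun x b₁ b₂ h₁ h₂ =>
    (hcl x b₁ b₂ h₁ h₂).lift Sum.inl fun c d hcd => ⟨.inl (by simpa using hcd.1), hcd.2⟩
  have hright : ∀ (x : W) (b₁ b₂ : ι'), x ∈ reach D'' (f' '' bag' b₁) →
      x ∈ reach D'' (f' '' bag' b₂) →
      ReflTransGen (fun c d => ((T ⊕g T') ⊔ SimpleGraph.edge (.inl a) (.inr a')).Adj c d ∧
        x ∈ reach D'' (Sum.elim (fun b => f '' bag b) (fun b => f' '' bag' b) c) ∧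
        x ∈ reach D'' (Sum.elim (fun b => f '' bag b) (fun b => f' '' bag' b) d))
        (.inr b₁) (.inr b₂) := fun x b₁ b₂ h₁ h₂ =>
    (hcr x b₁ b₂ h₁ h₂).lift Sum.inr fun c d hcd => ⟨.inl (by simpa using hcd.1), hcd.2⟩
  have hmixed : ∀ (x : W) (b₁ : ι) (b₂ : ι'), x ∈ reach D'' (f '' bag b₁) →
      x ∈ reach D'' (f' '' bag' b₂) →
      ReflTransGen (fun c d => ((T ⊕g T') ⊔ SimpleGraph.edge (.inl a) (.inr a')).Adj c d ∧
        x ∈ reach D'' (Sum.elim (fun b => f '' bag b) (fun b => f' '' bag' b) c) ∧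
        x ∈ reach D'' (Sum.elim (fun b => f '' bag b) (fun b => f' '' bag' b) d))
        (.inl b₁) (.inr b₂) := by
    intro x b₁ b₂ h₁ h₂
    have hux : ReflTransGen D''.Adj (f u) x := by
      obtain ⟨_, ⟨s, -, rfl⟩, hs⟩ := h₁
      obtain ⟨_, ⟨s', -, rfl⟩, hs'⟩ := h₂
      exact g.reach_of_both hs hs'
    have hxa := mem_reach_of_reflTransGen hfa hux
    have hxa' := mem_reach_of_reflTransGen hfa' hux
    refine (hleft x b₁ a h₁ hxa).trans (.head ?_ (hright x a' b₂ hxa' h₂))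
    exact ⟨.inr (by simp [SimpleGraph.edge_adj]), hxa, hxa'⟩
  refine ⟨ι ⊕ ι', inferInstance, (T ⊕g T') ⊔ SimpleGraph.edge (.inl a) (.inr a'),
    Sum.elim (fun b => f '' bag b) (fun b => f' '' bag' b), isTree_sum_sup_edge hT hT' a a', ?_, ?_,
    ?_⟩
  · rintro (b | b)
    · exact (hbag b).image f
    · exact (hbag' b).image f'
  · rw [Set.iUnion_sum]
    simp only [Sum.elim_inl, Sum.elim_inr, ← Set.image_iUnion, hcov, hcov']
  · rintro x (b₁ | b₁) (b₂ | b₂) h₁ h₂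
    · exact hleft x b₁ b₂ h₁ h₂
    · exact hmixed x b₁ b₂ h₁ h₂
    · exact reflTransGen_symm (fun _ _ h => ⟨h.1.symm, h.2.2, h.2.1⟩) (hmixed x b₂ b₁ h₂ h₁)
    · exact hright x b₁ b₂ h₁ h₂

/-- If a source `x` of `D` is not a source of the gluing, then `x = u`, and a source of `D'` lies
strictly above it. -/
theorem DagGluing.exists_source_above (g : DagGluing D D' D'' f f' u v u' v') {S' : Set V'}
    (hS' : S' ⊆ sources D') (hu' : u' ∈ reach D' S') {x : V} (hx : x ∈ sources D)
    (h : f x ∉ sources D'') :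
    x = u ∧ ∃ s ∈ S', ReflTransGen D'.Adj s u' ∧ f' s ≠ f x ∧ f' s ∈ sources D'' := by
  obtain ⟨rfl, hus⟩ := g.eq_of_notMem_sources hx h
  obtain ⟨s, hs, hsu⟩ := hu'
  refine ⟨rfl, s, hs, hsu, fun heq => ?_, ?_⟩
  · rw [g.map_eq] at heq
    exact hus (f'.injective heq ▸ hS' hs)
  · by_contra hcon
    exact (g.symm.eq_of_notMem_sources (hS' hs) hcon).2 hx

theorem DagGluing.hasJoinTree_union_inter_sources (g : DagGluing D D' D'' f f' u v u' v')
    {S : Set V} {S' : Set V'} (hS : S ⊆ sources D) (hS' : S' ⊆ sources D') (h : HasJoinTree D S)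
    (h' : HasJoinTree D' S') (hu : u ∈ reach D S) (hu' : u' ∈ reach D' S') :
    HasJoinTree D'' ((f '' S ∪ f' '' S') ∩ sources D'') := by
  have hglue := g.hasJoinTree_union h h' hu hu'
  have hrest : ∀ w ∈ f '' S ∪ f' '' S', w ∉ sources D'' → w = f u := by
    rintro _ (⟨s, hs, rfl⟩ | ⟨s, hs, rfl⟩) hw
    · rw [(g.eq_of_notMem_sources (hS hs) hw).1]
    · rw [(g.symm.eq_of_notMem_sources (hS' hs) hw).1, g.map_eq]
  by_cases hall : f '' S ∪ f' '' S' ⊆ sources D''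
  · rwa [Set.inter_eq_left.2 hall]
  · obtain ⟨w, hw, hws⟩ := Set.not_subset.1 hall
    have hwu := hrest w hw hws
    have heq : (f '' S ∪ f' '' S') ∩ sources D'' = (f '' S ∪ f' '' S') \ {f u} := by
      ext y
      refine and_congr_right fun hy => ⟨fun h1 h2 => hws (hwu ▸ h2 ▸ h1), fun h1 => ?_⟩
      by_contra h2
      exact h1 (hrest y hy h2)
    rw [heq, ← hwu]
    rcases hw with ⟨s, hs, rfl⟩ | ⟨s, hs, rfl⟩
    · obtain ⟨rfl, a, ha, hau, hne, -⟩ := g.exists_source_above hS' hu' (hS hs) hws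
      exact hglue.diff_singleton (.inr ⟨a, ha, rfl⟩) hne (g.map_eq ▸ g.symm.reach_map hau)
    · obtain ⟨rfl, a, ha, hau, hne, -⟩ := g.symm.exists_source_above hS hu (hS' hs) hws
      exact hglue.diff_singleton (.inl ⟨a, ha, rfl⟩) hne (g.map_eq ▸ g.reach_map hau)

theorem DagGluing.finite [Finite V] [Finite V'] (g : DagGluing D D' D'' f f' u v u' v') :
    Finite W :=
  Set.finite_univ_iff.1 (g.cover ▸ (Set.finite_range f).union (Set.finite_range f'))

theorem DagGluing.dagTreewidth_eq_one [Finite V] [Finite V']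
    (g : DagGluing D D' D'' f f' u v u' v') (h : dagTreewidth D = 1) (h' : dagTreewidth D' = 1) :
    dagTreewidth D'' = 1 := by
  have := g.finite
  rw [dagTreewidth_eq_one_iff] at h h' ⊢
  have hu : u ∈ reach D (sources D) := by simp [reach_sources_eq_univ g.isDAG_left]
  have hu' : u' ∈ reach D' (sources D') := by simp [reach_sources_eq_univ g.isDAG_right]
  constructor
  · have := g.hasJoinTree_union_inter_sources subset_rfl subset_rfl h.1 h'.1 hu hu'
    rwa [Set.inter_eq_right.2 g.sources_subset] at this
  · have hu'' : f u ∈ reach D'' (sources D'') := by simp [reach_sources_eq_univ g.isDAG]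
    obtain ⟨s, hs, -⟩ := hu''
    exact ⟨s, hs⟩

end GluedJoinTrees

/-! ### Cycle reductions of a gluing -/

section GluedReductions

variable {V : Type u₁} {V' : Type u₂} {W : Type u₃}

open Relation

variable {D : Digraph V} {D' : Digraph V'} {D'' : Digraph W} {f : V ↪ W} {f' : V' ↪ W}
  {u v : V} {u' v' : V'}

theorem DagGluing.connected (g : DagGluing D D' D'' f f' u v u' v')
    (h : D.toSimpleGraphInclusive.Connected) (h' : D'.toSimpleGraphInclusive.Connected) :
    D''.toSimpleGraphInclusive.Connected := by
  let φ : D.toSimpleGraphInclusive →g D''.toSimpleGraphInclusive :=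
    ⟨f, fun {a b} hab => ⟨fun he => hab.1 (f.injective he), hab.2.imp
      (fun h => (g.adj _ _).2 (.inl ⟨a, b, h, rfl, rfl⟩))
      (fun h => (g.adj _ _).2 (.inl ⟨b, a, h, rfl, rfl⟩))⟩⟩
  let φ' : D'.toSimpleGraphInclusive →g D''.toSimpleGraphInclusive :=
    ⟨f', fun {a b} hab => ⟨fun he => hab.1 (f'.injective he), hab.2.imp
      (fun h => (g.adj _ _).2 (.inr ⟨a, b, h, rfl, rfl⟩))
      (fun h => (g.adj _ _).2 (.inr ⟨b, a, h, rfl, rfl⟩))⟩⟩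
  have key : ∀ w, D''.toSimpleGraphInclusive.Reachable (f u) w := fun w => by
    rcases g.eq_or_eq w with ⟨x, rfl⟩ | ⟨x, rfl⟩
    · exact (h.preconnected u x).map φ
    · rw [g.map_eq]
      exact (h'.preconnected u' x).map φ'
  have : Nonempty W := ⟨f u⟩
  exact ⟨fun a b => (key a).symm.trans (key b)⟩

/-- Gluing a graph with a join tree preserves cycle reductions. All sources of `D'` join the part
`S i₀` of a part index `i₀` with `u ∈ reach D (S i₀)`, and the intersection sets are pulled back
to the gluing. If the distinguished source of `S i₀` is `u` and ceases to be a source, a source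
of `D'` above `u'` takes its place. -/
theorem DagGluing.nonempty_cycleReduction [Finite V] [Finite V']
    (g : DagGluing D D' D'' f f' u v u' v') {k : ℕ} (hk : 3 ≤ k) (R : CycleReduction D k)
    (h' : HasJoinTree D' (sources D')) : Nonempty (CycleReduction D'' k) := by
  classical
  have := g.finite
  have : Fact (1 < k) := ⟨by omega⟩
  have hSsrc : ∀ i, R.S i ⊆ sources D := fun i => R.cover ▸ Set.subset_iUnion R.S i
  obtain ⟨i₀, hi₀⟩ : ∃ i, u ∈ reach D (R.S i) := by
    obtain ⟨s, hs, hsu⟩ : u ∈ reach D (sources D) := by simp [reach_sources_eq_univ g.isDAG_left]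
    obtain ⟨i, hi⟩ := Set.mem_iUnion.1 (R.cover ▸ hs)
    exact ⟨i, s, hi, hsu⟩
  have hv₀ : v ∈ reach D (R.S i₀) := mem_reach_of_reflTransGen hi₀ g.reach_link
  have hu' : u' ∈ reach D' (sources D') := by simp [reach_sources_eq_univ g.isDAG_right]
  -- A source reachable from `S i₀` lies in `S i₀`, so the other parts avoid the merged vertices.
  have hout : ∀ j, j ≠ i₀ → ∀ s ∈ R.S j, s ∉ reach D (R.S i₀) := by
    rintro j hj s hs ⟨t, ht, hts⟩
    rcases ReflTransGen.cases_tail hts with rfl | ⟨w, -, hw⟩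
    · exact Set.disjoint_left.1 (R.disjoint j i₀ hj) hs ht
    · exact hSsrc j hs w hw
  obtain ⟨ρ, hρ, hρf, hρf'⟩ := g.exists_pullback
  let S'' : ZMod k → Set W := fun i =>
    if i = i₀ then (f '' R.S i₀ ∪ f' '' sources D') ∩ sources D'' else f '' R.S i
  have hS₀ : S'' i₀ = (f '' R.S i₀ ∪ f' '' sources D') ∩ sources D'' := if_pos rfl
  have hSne : ∀ i, i ≠ i₀ → S'' i = f '' R.S i := fun i hi => if_neg hi
  have hS''src : ∀ i, S'' i ⊆ sources D'' := by
    intro i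
    by_cases hi : i = i₀
    · rw [hi, hS₀]
      exact Set.inter_subset_right
    · rw [hSne i hi]
      rintro _ ⟨s, hs, rfl⟩
      by_contra hcon
      exact hout i hi s hs ((g.eq_of_notMem_sources (hSsrc i hs) hcon).1 ▸ hi₀)
  have hdisj₀ : ∀ j, j ≠ i₀ → Disjoint (S'' i₀) (S'' j) := by
    intro j hj
    rw [hS₀, hSne j hj, Set.disjoint_left]
    rintro _ ⟨⟨s, hs, rfl⟩ | ⟨s, hs, rfl⟩, -⟩ ⟨t, ht, hts⟩
    · exact hout j hj t ht (f.injective hts ▸ subset_reach D _ hs)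
    · rcases (g.glue t s).1 hts with ⟨rfl, -⟩ | ⟨rfl, -⟩
      · exact hout j hj _ ht hi₀
      · exact hout j hj _ ht hv₀
  have hdisj : ∀ i j, i ≠ j → Disjoint (S'' i) (S'' j) := by
    intro i j hij
    by_cases hi : i = i₀
    · subst hi
      exact hdisj₀ j hij.symm
    by_cases hj : j = i₀
    · subst hj
      exact (hdisj₀ i hij).symm
    · rw [hSne i hi, hSne j hj]
      exact (Set.disjoint_image_iff f.injective).2 (R.disjoint i j hij)
  -- On the domain of `ρ`, reachability from the new parts is pulled back along `ρ`.
  have hreachS : ∀ i y z, z ∈ ρ y → (y ∈ reach D'' (S'' i) ↔ z ∈ reach D (R.S i)) := by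
    intro i y z hz
    have himage : y ∈ reach D'' (f '' R.S i) ↔ z ∈ reach D (R.S i) := by
      rw [hρ]
      exact ⟨fun ⟨z', hz', h⟩ => Option.mem_unique hz' hz ▸ h, fun h => ⟨z, hz, h⟩⟩
    by_cases hi : i = i₀
    · subst hi
      rw [hS₀]
      constructor
      · rintro ⟨t, ⟨ht | ⟨s, -, rfl⟩, -⟩, hty⟩
        · exact himage.1 ⟨t, ht, hty⟩
        · rcases g.eq_or_eq y with ⟨x, rfl⟩ | ⟨x, rfl⟩
          · rw [hρf, Option.mem_def, Option.some.injEq] at hz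
            subst hz
            rcases g.symm.reach_cross_iff.1 hty with ⟨-, h⟩ | ⟨-, h⟩
            · exact mem_reach_of_reflTransGen hi₀ h
            · exact mem_reach_of_reflTransGen hv₀ h
          · rcases (hρf' x z hz).1 with rfl | rfl
            · exact hi₀
            · exact hv₀
      · intro h
        obtain ⟨_, ⟨s, hs, rfl⟩, hsy⟩ := himage.2 h
        by_cases hss : f s ∈ sources D''
        · exact ⟨f s, ⟨.inl ⟨s, hs, rfl⟩, hss⟩, hsy⟩
        · obtain ⟨rfl, a, ha, hau, -, has⟩ :=
            g.exists_source_above subset_rfl hu' (hSsrc _ hs) hss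
          exact ⟨f' a, ⟨.inr ⟨a, ha, rfl⟩, has⟩, (g.map_eq ▸ g.symm.reach_map hau).trans hsy⟩
    · rw [hSne i hi, himage]
  have hdom : ∀ i, i ≠ i₀ → ∀ y ∈ reach D'' (S'' i), ∃ z, z ∈ ρ y := by
    intro i hi y hy
    rw [hSne i hi, hρ] at hy
    exact ⟨hy.choose, hy.choose_spec.1⟩
  have hdom₂ : ∀ i j, i ≠ j → ∀ y, y ∈ reach D'' (S'' i) → y ∈ reach D'' (S'' j) →
      ∃ z, z ∈ ρ y := by
    intro i j hij y hi hj
    by_cases h : i = i₀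
    · exact hdom j (h ▸ hij.symm) y hj
    · exact hdom i h y hi
  have hreachf : ∀ s y z, z ∈ ρ y → (y ∈ reach D'' {f s} ↔ z ∈ reach D {s}) := by
    intro s y z hz
    rw [← Set.image_singleton, hρ]
    exact ⟨fun ⟨z', hz', h⟩ => Option.mem_unique hz' hz ▸ h, fun h => ⟨z, hz, h⟩⟩
  obtain ⟨t, htS, ht⟩ : ∃ t ∈ S'' i₀, ∀ y z, z ∈ ρ y →
      (y ∈ reach D'' {t} ↔ z ∈ reach D {R.s i₀}) := by
    by_cases hs : f (R.s i₀) ∈ sources D''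
    · exact ⟨f (R.s i₀), hS₀ ▸ ⟨.inl ⟨_, R.s_mem i₀, rfl⟩, hs⟩, hreachf _⟩
    · obtain ⟨hsu, a, ha, hau, -, has⟩ :=
        g.exists_source_above subset_rfl hu' (hSsrc _ (R.s_mem i₀)) hs
      refine ⟨f' a, hS₀ ▸ ⟨.inr ⟨a, ha, rfl⟩, has⟩, fun y z hz => ?_⟩
      rw [hsu, mem_reach_singleton, mem_reach_singleton]
      have hafu : ReflTransGen D''.Adj (f' a) (f' u') := g.symm.reach_map hau
      rcases g.eq_or_eq y with ⟨x, rfl⟩ | ⟨x, rfl⟩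
      · rw [hρf, Option.mem_def, Option.some.injEq] at hz
        subst hz
        constructor
        · intro h
          rcases g.symm.reach_cross_iff.1 h with ⟨-, h⟩ | ⟨-, h⟩
          · exact h
          · exact g.reach_link.trans h
        · exact fun h => (g.map_eq ▸ hafu).trans (g.reach_map h)
      · obtain ⟨hz, hx⟩ := hρf' x z hz
        refine iff_of_true (hafu.trans (g.symm.reach_map hx)) ?_
        rcases hz with rfl | rfl
        · exact .refl
        · exact g.reach_link
  let s'' : ZMod k → W := fun i => if i = i₀ then t else f (R.s i)
  have hs''S : ∀ i, s'' i ∈ S'' i := by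
    intro i
    by_cases hi : i = i₀
    · subst hi
      simpa [s''] using htS
    · rw [hSne i hi]
      simpa [s'', hi] using R.s_mem i
  have hreachs : ∀ i y z, z ∈ ρ y → (y ∈ reach D'' {s'' i} ↔ z ∈ reach D {R.s i}) := by
    intro i y z hz
    by_cases hi : i = i₀
    · subst hi
      simpa [s''] using ht y z hz
    · simpa [s'', hi] using hreachf (R.s i) y z hz
  have hs''reach : ∀ i, reach D'' {s'' i} ⊆ reach D'' (S'' i) := fun i =>
    reach_mono D'' (Set.singleton_subset_iff.2 (hs''S i))
  let I'' : ZMod k → Set W := fun i => {y | ∃ z, z ∈ ρ y ∧ z ∈ R.I i}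
  have hI'' : ∀ i y z, z ∈ ρ y → (y ∈ I'' i ↔ z ∈ R.I i) := fun i y z hz =>
    ⟨fun ⟨z', hz', h⟩ => Option.mem_unique hz' hz ▸ h, fun h => ⟨z, hz, h⟩⟩
  have hIU : ∀ y z, z ∈ ρ y → (y ∈ ⋃ i, I'' i ↔ z ∈ ⋃ i, R.I i) := fun y z hz => by
    simp only [Set.mem_iUnion, hI'' _ y z hz]
  have hIdom : ∀ y, y ∈ ⋃ i, I'' i → ∃ z, z ∈ ρ y := fun y hy => by
    obtain ⟨i, z, hz, -⟩ := Set.mem_iUnion.1 hy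
    exact ⟨z, hz⟩
  -- Sets contained in the domain of `ρ` agree if they are pulled back from the same set.
  have hext : ∀ (A B : Set W), (∀ y ∈ A, ∃ z, z ∈ ρ y) → (∀ y ∈ B, ∃ z, z ∈ ρ y) →
      (∀ y z, z ∈ ρ y → (y ∈ A ↔ y ∈ B)) → A = B := by
    intro A B hA hB h
    ext y
    exact ⟨fun hy => let ⟨z, hz⟩ := hA y hy; (h y z hz).1 hy,
      fun hy => let ⟨z, hz⟩ := hB y hy; (h y z hz).2 hy⟩
  have hsucc : ∀ i : ZMod k, i ≠ i + 1 := fun i h => by simp at h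
  have hinter : ∀ i, reach D'' (S'' i) ∩ reach D'' (S'' (i + 1)) = I'' i := fun i => by
    refine hext _ _ (fun y hy => hdom₂ _ _ (hsucc i) y hy.1 hy.2) (fun y ⟨z, hz, _⟩ => ⟨z, hz⟩)
      fun y z hz => ?_
    rw [Set.mem_inter_iff, hreachS i y z hz, hreachS (i + 1) y z hz, hI'' i y z hz, ← R.inter_succ,
      Set.mem_inter_iff]
  refine ⟨⟨S'', s'', I'', hdisj, ?_, hs''S, fun i => ?_, fun i => ?_, ?_, hinter, fun i => ?_,
    fun i j hij => ?_, fun i j hij y hy => ?_⟩⟩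
  · refine (Set.iUnion_subset hS''src).antisymm fun w hw => ?_
    rcases g.sources_subset hw with ⟨x, hx, rfl⟩ | ⟨x, hx, rfl⟩
    · obtain ⟨i, hi⟩ := Set.mem_iUnion.1 (R.cover ▸ hx)
      refine Set.mem_iUnion.2 ⟨i, ?_⟩
      by_cases h : i = i₀
      · subst h
        exact hS₀ ▸ ⟨.inl ⟨x, hi, rfl⟩, hw⟩
      · exact hSne i h ▸ ⟨x, hi, rfl⟩
    · exact Set.mem_iUnion.2 ⟨i₀, hS₀ ▸ ⟨.inr ⟨x, hx, rfl⟩, hw⟩⟩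
  · refine (rooted_reachDigraph_iff (hS''src i)).2 ⟨?_, hs''S i⟩
    have hR := ((rooted_reachDigraph_iff (hSsrc i)).1 (R.rooted i)).1
    by_cases hi : i = i₀
    · subst hi
      rw [hS₀]
      exact g.hasJoinTree_union_inter_sources (hSsrc i) subset_rfl hR h' hi₀ hu'
    · rw [hSne i hi]
      exact g.hasJoinTree_image hR
  · rw [← hinter]
    rintro y ⟨⟨a, ha, hay⟩, ⟨b, hb, hby⟩⟩
    refine ⟨a, hS''src _ ha, b, hS''src _ hb, ?_, mem_reach_singleton.2 hay,
      mem_reach_singleton.2 hby⟩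
    rintro rfl
    exact Set.disjoint_left.1 (hdisj _ _ (hsucc i)) ha hb
  · rintro y i m hm ⟨z, hz, hzi⟩ hyim
    rw [hI'' _ y z hz] at hyim
    simpa only [hI'' _ y z hz] using R.consecutive z i m hm hzi hyim
  · refine hext _ _ ?_ (fun y hy => hIdom y hy.2) fun y z hz => ?_
    · rintro y (⟨z, hz, -⟩ | ⟨z, hz, -⟩) <;> exact ⟨z, hz⟩
    · rw [Set.mem_union, hI'' _ y z hz, hI'' _ y z hz, ← Set.mem_union, R.union_eq,
        Set.mem_inter_iff, Set.mem_inter_iff, hreachS i y z hz, hIU y z hz]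
  · refine hext _ _ (fun y hy => hdom₂ i j hij.symm y hy.1 hy.2)
      (fun y hy => hdom₂ i j hij.symm y (hs''reach i hy.1) (hs''reach j hy.2)) fun y z hz => ?_
    rw [Set.mem_inter_iff, hreachS i y z hz, hreachS j y z hz, ← Set.mem_inter_iff,
      R.inter_eq i j hij, Set.mem_inter_iff, Set.mem_inter_iff, hreachs i y z hz, hreachs j y z hz]
  · obtain ⟨z, hz⟩ := hdom₂ i j hij.symm y (hs''reach i hy.1) (hs''reach j hy.2)
    rw [hIU y z hz]
    exact R.inter_subset i j hij ⟨(hreachs i y z hz).1 hy.1, (hreachs j y z hz).1 hy.2⟩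

theorem DagGluing.isCycleReducible [Finite V] [Finite V']
    (g : DagGluing D D' D'' f f' u v u' v') {k : ℕ} (h : IsCycleReducible k D)
    (hconn : D'.toSimpleGraphInclusive.Connected) (h' : HasJoinTree D' (sources D')) :
    IsCycleReducible k D'' := by
  obtain ⟨hk, -, hD, ⟨R⟩⟩ := h
  exact ⟨hk, g.isDAG, g.connected hD hconn, g.nonempty_cycleReduction hk R h'⟩

end GluedReductions

/-! ### Gluing patterns -/

section GluedPatterns

variable {V : Type u₁} {V' : Type u₂} {W : Type u₃}

open Relation

theorem toSimpleGraphInclusive_eq {G : SimpleGraph V} {D : Digraph V}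
    (h : IsAcyclicOrientation G D) : D.toSimpleGraphInclusive = G := by
  ext a b
  exact ⟨fun hab => (h.2 a b).2 hab.2, fun hab => ⟨hab.ne, (h.2 a b).1 hab⟩⟩

/-- An orientation of a gluing restricts to an orientation of either part. -/
theorem isAcyclicOrientation_restrict {G : SimpleGraph V} {G'' : SimpleGraph W} {D'' : Digraph W}
    (f : V ↪ W) (hf : ∀ a b, G.Adj a b → G''.Adj (f a) (f b))
    (hD : IsAcyclicOrientation G'' D'') :
    IsAcyclicOrientation G ⟨fun a b => G.Adj a b ∧ D''.Adj (f a) (f b)⟩ := by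
  refine ⟨fun x hx => hD.1 (f x) (hx.lift f fun a b h => h.2), fun a b => ⟨fun h => ?_, ?_⟩⟩
  · exact ((hD.2 _ _).1 (hf a b h)).imp (fun h' => ⟨h, h'⟩) fun h' => ⟨h.symm, h'⟩
  · exact fun h => h.elim And.left fun h => h.1.symm

theorem IsCycleComputable.of_gluing [Finite V] [Finite V'] {k : ℕ} {H : SimpleGraph V}
    {H' : SimpleGraph V'} {H'' : SimpleGraph W} (hH : IsCycleComputable k H) (hconn : H'.Connected)
    (hlicl : licl H' < 6) {f : V ↪ W} {f' : V' ↪ W} {u v : V} {u' v' : V'}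
    (hcover : Set.range f ∪ Set.range f' = Set.univ)
    (hglue : ∀ x y, f x = f' y ↔ ((x = u ∧ y = u') ∨ (x = v ∧ y = v')))
    (hadj : ∀ a b, H''.Adj a b ↔ (Relation.Map H.Adj f f a b ∨ Relation.Map H'.Adj f' f' a b))
    (hlink : (u = v ∧ u' = v') ∨ (H.Adj u v ∧ H'.Adj u' v')) : IsCycleComputable k H'' := by
  intro D'' hD''
  have hf : ∀ a b, H.Adj a b → H''.Adj (f a) (f b) := fun a b h =>
    (hadj _ _).2 (.inl ⟨a, b, h, rfl, rfl⟩)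
  have hf' : ∀ a b, H'.Adj a b → H''.Adj (f' a) (f' b) := fun a b h =>
    (hadj _ _).2 (.inr ⟨a, b, h, rfl, rfl⟩)
  let D : Digraph V := ⟨fun a b => H.Adj a b ∧ D''.Adj (f a) (f b)⟩
  let D' : Digraph V' := ⟨fun a b => H'.Adj a b ∧ D''.Adj (f' a) (f' b)⟩
  have hD : IsAcyclicOrientation H D := isAcyclicOrientation_restrict f hf hD''
  have hD' : IsAcyclicOrientation H' D' := isAcyclicOrientation_restrict f' hf' hD''
  have hadj'' : ∀ a b, D''.Adj a b ↔
      (Relation.Map D.Adj f f a b ∨ Relation.Map D'.Adj f' f' a b) := by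
    refine fun a b => ⟨fun h => ?_, ?_⟩
    · rcases (hadj a b).1 ((hD''.2 a b).2 (.inl h)) with ⟨x, y, hxy, rfl, rfl⟩ |
        ⟨x, y, hxy, rfl, rfl⟩
      · exact .inl ⟨x, y, ⟨hxy, h⟩, rfl, rfl⟩
      · exact .inr ⟨x, y, ⟨hxy, h⟩, rfl, rfl⟩
    · rintro (⟨x, y, hxy, rfl, rfl⟩ | ⟨x, y, hxy, rfl, rfl⟩)
      exacts [hxy.2, hxy.2]
  -- The orientation of a merged edge decides which of its ends comes first.
  obtain ⟨p, q, p', q', g⟩ : ∃ p q p' q', DagGluing D D' D'' f f' p q p' q' := by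
    have hu : f u = f' u' := (hglue u u').2 (.inl ⟨rfl, rfl⟩)
    have hv : f v = f' v' := (hglue v v').2 (.inr ⟨rfl, rfl⟩)
    rcases hlink with h | ⟨h, h'⟩
    · exact ⟨u, v, u', v', hD.1, hD'.1, hcover, hglue, hadj'', .inl h⟩
    · rcases (hD''.2 _ _).1 (hf u v h) with huv | hvu
      · exact ⟨u, v, u', v', hD.1, hD'.1, hcover, hglue, hadj'', .inr ⟨⟨h, huv⟩, h', hu ▸ hv ▸ huv⟩⟩
      · exact ⟨v, u, v', u', hD.1, hD'.1, hcover, fun x y => (hglue x y).trans or_comm, hadj'',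
          .inr ⟨⟨h.symm, hvu⟩, h'.symm, hu ▸ hv ▸ hvu⟩⟩
  have hne : (sources D').Nonempty := by
    obtain ⟨x⟩ := hconn.nonempty
    obtain ⟨s, hs, -⟩ : x ∈ reach D' (sources D') := by simp [reach_sources_eq_univ hD'.1]
    exact ⟨s, hs⟩
  have hjoin : HasJoinTree D' (sources D') := hasJoinTree_sources hD'.2
    (fun n hn => isEmpty_cycleGraph_embedding_of_licl_lt hlicl hn (by omega)) hne
  rcases hH D hD with h | ⟨l, hl, h⟩
  · exact .inl (g.dagTreewidth_eq_one h (dagTreewidth_eq_one_iff.2 ⟨hjoin, hne⟩))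
  · exact .inr ⟨l, hl, g.isCycleReducible h ((toSimpleGraphInclusive_eq hD').symm ▸ hconn) hjoin⟩

end GluedPatterns

end CycleComputable

open CycleComputable in
theorem mainTheorem9 {V : Type u₁} {V' : Type u₂} {W : Type u₃} [Finite V] [Finite V'] :
    -- gluing two DAGs of DAG-treewidth one, along a vertex or along an arc
    (∀ (P : Digraph V) (P' : Digraph V') (P'' : Digraph W),
      IsDAG P → IsDAG P' → dagTreewidth P = 1 → dagTreewidth P' = 1 →
      (∀ (u : V) (u' : V'), IsVertexGluing u u' P.Adj P'.Adj P''.Adj →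
        IsDAG P'' ∧ dagTreewidth P'' = 1) ∧
      (∀ (u v : V) (u' v' : V'), P.Adj u v → P'.Adj u' v' →
        IsEdgeGluing u v u' v' P.Adj P'.Adj P''.Adj →
        IsDAG P'' ∧ dagTreewidth P'' = 1)) ∧
    -- gluing a computable pattern and a connected pattern without long induced cycles
    (∀ (k : ℕ) (H : SimpleGraph V) (H' : SimpleGraph V') (H'' : SimpleGraph W),
      IsCycleComputable k H → H'.Connected → licl H' < 6 →
      (∀ (u : V) (u' : V'), IsVertexGluing u u' H.Adj H'.Adj H''.Adj →
        IsCycleComputable k H'') ∧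
      (∀ (u v : V) (u' v' : V'), H.Adj u v → H'.Adj u' v' →
        IsEdgeGluing u v u' v' H.Adj H'.Adj H''.Adj →
        IsCycleComputable k H'')) := by
  refine ⟨fun P P' P'' hP hP' h h' => ⟨?_, ?_⟩, fun k H H' H'' hH hconn hlicl => ⟨?_, ?_⟩⟩
  · rintro u u' ⟨f, f', hcover, hglue, hadj⟩
    have g : DagGluing P P' P'' f f' u u u' u' :=
      ⟨hP, hP', hcover, fun x y => (hglue x y).trans (or_self_iff).symm, hadj, .inl ⟨rfl, rfl⟩⟩
    exact ⟨g.isDAG, g.dagTreewidth_eq_one h h'⟩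
  · rintro u v u' v' huv huv' ⟨f, f', hcover, hglue, hadj⟩
    have g : DagGluing P P' P'' f f' u v u' v' :=
      ⟨hP, hP', hcover, hglue, hadj, .inr ⟨huv, huv'⟩⟩
    exact ⟨g.isDAG, g.dagTreewidth_eq_one h h'⟩
  · rintro u u' ⟨f, f', hcover, hglue, hadj⟩
    exact hH.of_gluing hconn hlicl hcover (fun x y => (hglue x y).trans (or_self_iff).symm) hadj
      (.inl ⟨rfl, rfl⟩)
  · rintro u v u' v' huv huv' ⟨f, f', hcover, hglue, hadj⟩
    exact hH.of_gluing hconn hlicl hcover hglue hadj (.inr ⟨huv, huv'⟩)
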